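/- **Conventions.** Let $X=\{0,1\}$, let $X^\omega$ be the Cantor set of infinite words over $X$, and let $\sigma$ be the shift $\sigma(x_1x_2x_3\ldots)=x_2x_3\ldots$. Thompson's group $F$ acts on $X^\omega$ in the standard way: it is generated by $$x_0:\ 0z\mapsto 00z,\quad 10z\mapsto 01z,\quad 11z\mapsto 1z;\qquad x_1:\ 0z\mapsto 0z,\quad 10z\mapsto 100z,\quad 110z\mapsto 101z,\quad 111z\mapsto 11z .$$ The Schreier graph $\Gamma_x$ of $x\in X^\omega$ has the orbit of $x$ under $F$ as its vertex set (each vertex is labeled by itself), an arrow labeled $s\in\{x_0,x_1\}$ from $a$ to $b$ if and only if $s$ sends $a$ to $b$, and base vertex $x$. Vertices $0z$, $10z$, $11z$ are called black, grey and white. A *start* is a word $1^n0$ or $0^m1$ with $n,m\ge 1$. A point of $X^\omega$ is rational if it is eventually periodic. $\Gamma=\Gamma_{10^\infty}$ denotes the Schreier graph of $\frac12$; its vertices are written without the trailing zeros. *Graphs with a spine.* Start with a spine of grey vertices, which is either an infinite path $g_0,g_1,g_2,\ldots$ going up or a cycle, where each step up from a spine vertex to the next one carries a letter; the lower vertex is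 then the child of that type of the upper one. Attach binary trees of grey vertices going down so that every grey vertex has exactly one child of type $0$ and one child of type $1$ (on the spine one of these may be the spine vertex below). To each grey vertex $c$ attach black vertices $b_1,b_2,\ldots$ and white vertices $c_2,c_3,\ldots$ (put $c_1=c$), with arrows $x_0: c\to b_1$, $b_m\to b_{m+1}$, $c_{n+1}\to c_n$ $(m,n\ge1)$, and $x_1: b_m\to b_m$, $c_{n+1}\to c_n$ $(n\ge 2)$, $c\to$ (child of type $0$), $c_2\to$ (child of type $1$). A step up with letter $0$ *turns left* (an arrow $x_1$ from the upper to the lower vertex); a step up with letter $1$ *turns right* (a white vertex with arrows $x_0$ to the upper and $x_1$ to the lower vertex). If a spine vertex is labeled $10z$, then the grey vertex obtained from it by going down along a finite word $p$, read from its last letter to its first, is labeled $10pz$, and the vertices $b_m$, $c_n$ attached to it are labeled $0^m1pz$, $1^n0pz$. For $u\in X^\omega$ and a start $a$, the graph $\tilde\Gamma_{au}$ of type B is the graph whose spine is the infinite path with $k$-th step up ($k\ge1$) carrying the $k$-th letter of $u$, with $g_k$ labeled $10\sigma^k(u)$; its base vertex is the vertex with label $au$ at $g_0$. *Trees.* In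 $\Gamma_x$, the tree hanging down from a grey vertex $10u$ consists of all vertices $b\,p\,u$, $b$ a start and $p\in X^*$. The tree hanging down and to the left at the white vertex $110z$ consists of the vertices $1^n0z$, $n\ge2$, and the tree hanging down from $101z$; its root is $110z$. The tree hanging down and to the right at the grey vertex $10z$ is the tree hanging down from its child $100z$, which is its root. **Theorem.** Let $x\in X^\omega$ be rational, $x\ne 0^\infty,1^\infty$. Then $x$ can be uniquely written as $x=1^n0vw^\infty$ with $n\ge1$ or $x=0^m1vw^\infty$ with $m\ge1$, where $v,w\in X^*$, $w$ is nonempty and not a proper power, and $v$ is empty or its last letter differs from the last letter of $w$. For this $v,w$: (a) Gluing all vertices of $\tilde\Gamma_x$ with equal labels gives $\Gamma_x$, by an isomorphism of marked pointed graphs that preserves labels. (b) Explicitly, $\Gamma_x$ is isomorphic, with labels, to the graph whose spine is a cycle of $|w|$ grey vertices $10\sigma^i(w^\infty)$, $0\le i<|w|$, in which the step up from $10\sigma^i(w^\infty)$ to $10\sigma^{i+1}(w^\infty)$ carries the $(i+1)$-st letter of $w$; the base vertex sits at the grey vertex reached from $10w^\infty$ by going down along $v$. (c) For each vertex $10u$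 with $u\neq\sigma^i(w^\infty)$ for all $i$, the tree hanging down from $10u$ is attached to the rest of $\Gamma_x$ only at $10u$, and $b\,p\,u\mapsto b\,p\,10^\infty$ is a well-defined isomorphism of it onto the tree hanging down at the vertex $101$ in $\Gamma$. (d) The path $10vw^\infty,\ 10\sigma(vw^\infty),\ldots,\ 10\sigma^{|v|+|w|-1}(vw^\infty)=10\sigma^{|w|-1}(w^\infty)$ of grey vertices goes up, turns left or right at its $k$-th step if the $k$-th letter of $vw$ is $0$ or $1$ respectively, and its grey vertices are distinct. (e) If the last letter of $w$ is $0$, there is an arrow labeled $x_1$ from $10w^\infty$ to $10\sigma^{|w|-1}(w^\infty)$. (f) If the last letter of $w$ is $1$, the vertex $110w^\infty$ has arrows labeled $x_0$ to $10w^\infty$ and $x_1$ to $10\sigma^{|w|-1}(w^\infty)$. (g) The part of the path in (d) from $10w^\infty$ on (with the white vertices on it), closed up by (e) or (f), is a loop without repeated vertices, the *nontrivial loop*. It has exactly $|w|$ grey vertices. (For $|w|=1$ it is degenerate: one grey vertex with a loop $x_1$, or a grey and a white vertex joined by two arrows.) (h) Let $10z$ be a grey vertex of the nontrivial loop and $y$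 a vertex adjacent to it that is not on the loop. Then $y$ is one of the following, and the ray or tree in question is attached to the rest of $\Gamma_x$ only at $y$: the vertex $01z$, which is the beginning of the geodesic $01z,001z,0001z,\ldots$, isomorphic as a marked graph to the geodesic $1,01,001,\ldots$ in $\Gamma$; or the vertex $110z$, which is the root of the tree hanging down and to the left at $110z$, isomorphic as a rooted marked graph to the tree hanging down and to the left at the vertex $11$ in $\Gamma$; or the vertex $100z$, which is the root of the tree hanging down from it, isomorphic as a rooted marked graph to the tree hanging down and to the right at the vertex $101$ in $\Gamma$. -/

import Mathlib

/-! ### The Cantor set and the standard action of Thompson's group -/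

/-- The Cantor set `X^ω` of infinite words over the alphabet `X = {0, 1}`. The shift `σ` iterated
`k` times is `Stream'.drop k`; the concatenation of a finite word `p` with an infinite word `z`
is `p ++ₛ z`. -/
abbrev Cantor : Type := Stream' (Fin 2)

/-- The constant words `000…` and `111…`. -/
abbrev constWord (a : Fin 2) : Cantor := Stream'.const a

/-- The periodic word `w^∞ = www…` (meaningful for nonempty `w`). -/
def periodic (w : List (Fin 2)) : Cantor := fun n => w.getD (n % w.length) 0

/-- Rational elements of the Cantor set: the preperiodic sequences. -/
def IsRational (x : Cantor) : Prop := ∃ k p : ℕ, 0 < p ∧ x.drop (k + p) = x.drop k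

/-- The map `0w ↦ 00w`, `10w ↦ 01w`, `11w ↦ 1w`. -/
def x0Fun (z : Cantor) : Cantor :=
  if z.get 0 = 0 then [0, 0] ++ₛ z.drop 1
  else if z.get 1 = 0 then [0, 1] ++ₛ z.drop 2
  else [1] ++ₛ z.drop 2

/-- The inverse map `00w ↦ 0w`, `01w ↦ 10w`, `1w ↦ 11w`. -/
def x0Inv (z : Cantor) : Cantor :=
  if z.get 0 = 1 then [1, 1] ++ₛ z.drop 1
  else if z.get 1 = 0 then [0] ++ₛ z.drop 2
  else [1, 0] ++ₛ z.drop 2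

/-- The map `0w ↦ 0w`, `10w ↦ 100w`, `110w ↦ 101w`, `111w ↦ 11w`; that is, it fixes `0w` and sends
`1w` to `1 x₀(w)`. -/
def x1Fun (z : Cantor) : Cantor :=
  if z.get 0 = 0 then z
  else if z.get 1 = 0 then [1, 0, 0] ++ₛ z.drop 2
  else if z.get 2 = 0 then [1, 0, 1] ++ₛ z.drop 3
  else [1, 1] ++ₛ z.drop 3

/-- The inverse map `0w ↦ 0w`, `100w ↦ 10w`, `101w ↦ 110w`, `11w ↦ 111w`. -/
def x1Inv (z : Cantor) : Cantor :=
  if z.get 0 = 0 then z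
  else if z.get 1 = 1 then [1, 1, 1] ++ₛ z.drop 2
  else if z.get 2 = 0 then [1, 0] ++ₛ z.drop 3
  else [1, 1, 0] ++ₛ z.drop 3

theorem exists_eq_append (z : Cantor) :
    ∃ a b c : Fin 2, ∃ t : Cantor, z = [a, b, c] ++ₛ t :=
  ⟨z.get 0, z.get 1, z.get 2, z.drop 3, by
    funext n
    match n with
    | 0 => rfl
    | 1 => rfl
    | 2 => rfl
    | n + 3 => rfl⟩

/-- The generator `x₀` as a bijection of the Cantor set. -/
def x0Perm : Equiv.Perm Cantor where
  toFun := x0Fun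
  invFun := x0Inv
  left_inv z := by
    obtain ⟨a, b, c, t, rfl⟩ := exists_eq_append z
    fin_cases a <;> fin_cases b <;> fin_cases c <;> rfl
  right_inv z := by
    obtain ⟨a, b, c, t, rfl⟩ := exists_eq_append z
    fin_cases a <;> fin_cases b <;> fin_cases c <;> rfl

/-- The generator `x₁` as a bijection of the Cantor set. -/
def x1Perm : Equiv.Perm Cantor where
  toFun := x1Fun
  invFun := x1Inv
  left_inv z := by
    obtain ⟨a, b, c, t, rfl⟩ := exists_eq_append z
    fin_cases a <;> fin_cases b <;> fin_cases c <;> rfl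
  right_inv z := by
    obtain ⟨a, b, c, t, rfl⟩ := exists_eq_append z
    fin_cases a <;> fin_cases b <;> fin_cases c <;> rfl

/-- Names of the two generators. -/
inductive Gen
  | x0
  | x1

/-- The bijection of the Cantor set given by a generator. -/
def Gen.perm : Gen → Equiv.Perm Cantor
  | .x0 => x0Perm
  | .x1 => x1Perm

/-- Thompson's group `F` in its standard (faithful) action on the Cantor set: the group of
bijections of `X^ω` generated by `x₀` and `x₁`. -/
def thompsonF : Subgroup (Equiv.Perm Cantor) := Subgroup.closure (Set.range Gen.perm)

/-- The generating set `{x₀, x₁}` of `F`. -/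
def Gen.elt (s : Gen) : thompsonF := ⟨s.perm, Subgroup.subset_closure ⟨s, rfl⟩⟩

/-! ### Marked graphs and Schreier graphs -/

/-- An oriented graph on `V` with arrows labelled by generators: `edge s a b` means that there is
an arrow labelled `s` from `a` to `b`. -/
structure MarkedGraph (V : Type) where
  edge : Gen → V → V → Prop

namespace MarkedGraph

/-- Isomorphisms of marked graphs. -/
structure Iso {V W : Type} (Γ : MarkedGraph V) (Δ : MarkedGraph W) extends V ≃ W where
  edge_iff : ∀ (s : Gen) (a b : V), Δ.edge s (toFun a) (toFun b) ↔ Γ.edge s a b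

/-- The marked subgraph induced on a set of vertices. -/
def induce {V : Type} (Γ : MarkedGraph V) (S : Set V) : MarkedGraph S where
  edge s a b := Γ.edge s a b

/-- The marked graph obtained by gluing all vertices on which `label` takes the same value. -/
def glue {V L : Type} (Γ : MarkedGraph V) (label : V → L) :
    MarkedGraph (Quotient (Setoid.ker label)) where
  edge s A B := ∃ a b : V, Quotient.mk _ a = A ∧ Quotient.mk _ b = B ∧ Γ.edge s a b

/-- Two vertices are adjacent if some arrow joins them, in one direction or the other. -/
def Adj {V : Type} (Γ : MarkedGraph V) (a b : V) : Prop := ∃ s, Γ.edge s a b ∨ Γ.edge s b a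

/-- The underlying simple graph (forgetting labels, directions, multiplicities and loops). -/
def toSimpleGraph {V : Type} (Γ : MarkedGraph V) : SimpleGraph V := SimpleGraph.fromRel Γ.Adj

/-- A one-sided infinite geodesic `r 0, r 1, r 2, …`. -/
def IsGeodesicRay {V : Type} (Γ : MarkedGraph V) (r : ℕ → V) : Prop :=
  (∀ m, Γ.Adj (r m) (r (m + 1))) ∧ ∀ m k, Γ.toSimpleGraph.dist (r m) (r (m + k)) = k

/-- The part of `Γ` on the vertex set `S` is attached to the rest of `Γ` only at its root `r`:
every arrow between `S` and its complement has `r` as its end in `S`. -/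
def HangsAt {V : Type} (Γ : MarkedGraph V) (S : Set V) (r : V) : Prop :=
  r ∈ S ∧ ∀ s a b, Γ.edge s a b → (a ∈ S → b ∉ S → a = r) ∧ (a ∉ S → b ∈ S → b = r)

/-- The induced subgraphs of `Γ` on `S` with root `r` and of `Δ` on `T` with root `t` are
isomorphic as rooted marked graphs. -/
def RootedIso {V W : Type} (Γ : MarkedGraph V) (S : Set V) (r : V)
    (Δ : MarkedGraph W) (T : Set W) (t : W) : Prop :=
  ∃ (hr : r ∈ S) (ht : t ∈ T) (φ : (Γ.induce S).Iso (Δ.induce T)), φ.toEquiv ⟨r, hr⟩ = ⟨t, ht⟩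

end MarkedGraph

/-- The vertex set of the Schreier graph of `x`: the orbit of `x` under `F`. The label of a vertex
is the vertex itself, as an element of the Cantor set. -/
abbrev Orb (x : Cantor) : Type := MulAction.orbit thompsonF x

/-- The base vertex of the Schreier graph of `x`. -/
def basePt (x : Cantor) : Orb x := ⟨x, MulAction.mem_orbit_self x⟩

/-- The orbital Schreier graph of a set with an action of `F`, with respect to `{x₀, x₁}`: there is
an arrow labelled `s` from `a` to `b` if and only if `s` sends `a` to `b`. -/
def orbitalGraph (M : Type) [MulAction thompsonF M] : MarkedGraph M where
  edge s a b := s.elt • a = b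

/-- The Schreier graph `Γ_x` of the action of `F` on the orbit of `x`. -/
def schreier (x : Cantor) : MarkedGraph (Orb x) := orbitalGraph (Orb x)

/-! ### Normal forms -/

/-- The beginnings `0^m 1` and `1^n 0` with `m, n ≥ 1` of nonconstant infinite words:
`black m` stands for `0^(m+1) 1` and `white n` stands for `1^(n+1) 0`. The words with beginning
`white 0 = 10` are the labels of grey vertices. -/
inductive Start
  | black (m : ℕ)
  | white (n : ℕ)

/-- The finite word denoted by a beginning. -/
def Start.word : Start → List (Fin 2)
  | .black m => List.replicate (m + 1) 0 ++ [1]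
  | .white n => List.replicate (n + 1) 1 ++ [0]

/-- A finite word is primitive if it is nonempty and not a proper power. -/
def IsPrimitive (w : List (Fin 2)) : Prop :=
  w ≠ [] ∧ ∀ (u : List (Fin 2)) (n : ℕ), w = (List.replicate n u).flatten → n = 1

/-- `x = a v w^∞` where `a` is `1^n 0` or `0^m 1` (with `m, n ≥ 1`), `w` is primitive, and `v` does
not end with the last letter of `w` (in particular, `v` may be empty). -/
def IsNormalForm (x : Cantor) (a : Start) (v w : List (Fin 2)) : Prop :=
  x = a.word ++ₛ (v ++ₛ periodic w) ∧ IsPrimitive w ∧ v.getLast? ≠ w.getLast?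

/-! ### Explicit graphs: trees hanging from a spine

Grey vertices sit on a spine (an infinite path or a cycle) with index set `I`, or in the binary
trees hanging down from it. The function `down` describes the spine: `down i = some (b, j)` means
that the spine vertex right below `i` is `j`, and that `j` is the child of `i` of type `b`, where
the child of type `0` is joined to its parent by an arrow labelled `x₁` and the child of
type `1` is joined to its parent through a white vertex. -/

/-- The pair `(i, p)` is the grey vertex reached from the spine vertex `i` by descending along the
finite word `p`, read from its last letter to its first letter. It is reduced if the path leaves
the spine at once. -/
def Reduced {I : Type} (down : I → Option (Fin 2 × I)) (c : I × List (Fin 2)) : Prop :=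
  ∀ b j, down c.1 = some (b, j) → c.2.getLast? ≠ some b

/-- The grey vertices. -/
def Grey {I : Type} (down : I → Option (Fin 2 × I)) : Type :=
  {c : I × List (Fin 2) // Reduced down c}

/-- `d` is the child of type `a` of the grey vertex `c`: either it is obtained by descending one
more step in a hanging tree, or both vertices are on the spine and `d` is right below `c`. -/
def IsChild {I : Type} (down : I → Option (Fin 2 × I)) (a : Fin 2) (c d : Grey down) : Prop :=
  d.1 = (c.1.1, a :: c.1.2) ∨ (c.1.2 = [] ∧ d.1.2 = [] ∧ down c.1.1 = some (a, d.1.1))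

/-- The arrows. The vertex `(c, white 0)` is the grey vertex `c` itself; to each grey vertex are
attached an infinite ray of black vertices `(c, black m)` and an infinite ray of white vertices
`(c, white n)`, `n ≥ 1`. -/
inductive SpineEdge {I : Type} (down : I → Option (Fin 2 × I)) :
    Gen → Grey down × Start → Grey down × Start → Prop
  | x0_black (c : Grey down) (m : ℕ) : SpineEdge down .x0 (c, .black m) (c, .black (m + 1))
  | x0_grey (c : Grey down) : SpineEdge down .x0 (c, .white 0) (c, .black 0)
  | x0_white (c : Grey down) (n : ℕ) : SpineEdge down .x0 (c, .white (n + 1)) (c, .white n)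
  | x1_black (c : Grey down) (m : ℕ) : SpineEdge down .x1 (c, .black m) (c, .black m)
  | x1_grey (c d : Grey down) (h : IsChild down 0 c d) :
      SpineEdge down .x1 (c, .white 0) (d, .white 0)
  | x1_white_one (c d : Grey down) (h : IsChild down 1 c d) :
      SpineEdge down .x1 (c, .white 1) (d, .white 0)
  | x1_white (c : Grey down) (n : ℕ) : SpineEdge down .x1 (c, .white (n + 2)) (c, .white (n + 1))

/-- The marked graph with the given spine. -/
def spineGraph {I : Type} (down : I → Option (Fin 2 × I)) :
    MarkedGraph (Grey down × Start) where
  edge := SpineEdge down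

/-- The infinite spine with vertices `0, 1, 2, …` going upwards that turns at its successive levels
according to the successive letters of `u`. -/
def rayDown (u : Cantor) : ℕ → Option (Fin 2 × ℕ)
  | 0 => none
  | k + 1 => some (u.get k, k)

/-- The limit graph of type B whose infinite path going up turns left or right at the `k`-th level
if the `k`-th letter of `u` is `0` or `1` respectively. -/
def typeB (u : Cantor) : MarkedGraph (Grey (rayDown u) × Start) := spineGraph (rayDown u)

/-- The label of a vertex of the limit graph of type B. -/
def typeBLabel (u : Cantor) (t : Grey (rayDown u) × Start) : Cantor :=
  t.2.word ++ₛ (t.1.1.2 ++ₛ u.drop t.1.1.1)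

/-- The vertex of the limit graph of type B with label `a u` and bottom of the infinite path as its
grey vertex. The graph `typeB u` with this base vertex is the limit graph of the point `a u`. -/
def typeBBase (u : Cantor) (a : Start) : Grey (rayDown u) × Start :=
  (⟨(0, []), fun _ _ h => by simp [rayDown] at h⟩, a)

/-- The cyclic spine of length `|w|`: the vertex right below `i` is `i - 1` modulo `|w|`, and the
step from `i - 1` up to `i` turns according to the letter of `w` with (zero-based) index `i - 1`
modulo `|w|`. -/
def cycleDown (w : List (Fin 2)) (i : Fin w.length) : Option (Fin 2 × Fin w.length) :=
  let j : Fin w.length := ⟨(i + (w.length - 1)) % w.length, Nat.mod_lt _ (i.pos)⟩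
  some (w.get j, j)

/-- The graph consisting of one loop with `|w|` grey vertices that turns according to the
letters of `w`, and of the trees and rays attached to this loop. -/
def loopGraph (w : List (Fin 2)) : MarkedGraph (Grey (cycleDown w) × Start) :=
  spineGraph (cycleDown w)

/-! ### Pieces of Schreier graphs -/

/-- The point `1000…` (the binary expansion of `1/2`). -/
def half : Cantor := [1] ++ₛ constWord 0

/-- Grey vertices are those with labels `10z`. -/
def IsGrey {x : Cantor} (p : Orb x) : Prop := ∃ z : Cantor, (p : Cantor) = [1, 0] ++ₛ z

/-- White vertices are those with labels `11z`. -/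
def IsWhite {x : Cantor} (p : Orb x) : Prop := ∃ z : Cantor, (p : Cantor) = [1, 1] ++ₛ z

/-- The vertices of the tree hanging down from the grey vertex `10u`: the grey vertices
`10pu` with `p` a finite word, together with the black and the white rays at these
vertices. -/
def treeAt (x u : Cantor) : Set (Orb x) :=
  {y | ∃ (b : Start) (p : List (Fin 2)), (y : Cantor) = b.word ++ₛ (p ++ₛ u)}

/-- The vertices of the tree hanging down and to the left at the white vertex `110z`: the white
ray `110z, 1110z, …` and the tree hanging down from the grey vertex `101z`. -/
def leftTreeAt (x z : Cantor) : Set (Orb x) :=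
  {y | ∃ n : ℕ, (y : Cantor) = (Start.white (n + 1)).word ++ₛ z} ∪ treeAt x ([1] ++ₛ z)

/-- One step up from the grey vertex `p` to the grey vertex `q`. The step turns left (letter `0`) if
it goes along an arrow labelled `x₁` from `q` to `p`, and it turns right (letter `1`) if it
goes through a white vertex with arrows labelled `x₀` to `q` and `x₁` to `p`. -/
def StepUp {x : Cantor} (a : Fin 2) (p q : Orb x) : Prop :=
  IsGrey p ∧ IsGrey q ∧
    ((a = 0 ∧ (schreier x).edge .x1 q p) ∨
      (a = 1 ∧ ∃ t : Orb x, IsWhite t ∧ (schreier x).edge .x0 t q ∧ (schreier x).edge .x1 t p))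

/-- The labels of the vertices of the nontrivial loop, in cyclic order: the grey vertices
`10σ^i(w^∞)`, `0 ≤ i < |w|`, where `10σ^i(w^∞)` is followed by the white vertex `110σ^(i+1)(w^∞)`
if the letter of `w` with (zero-based) index `i` is `1`. -/
def loopLabels (w : List (Fin 2)) : List Cantor :=
  (List.range w.length).flatMap fun i =>
    if (periodic w).get i = 0 then [[1, 0] ++ₛ (periodic w).drop i]
    else [[1, 0] ++ₛ (periodic w).drop i, [1, 1, 0] ++ₛ (periodic w).drop (i + 1)]

/-- The vertex set of the nontrivial loop. -/
def loopSet (x : Cantor) (w : List (Fin 2)) : Set (Orb x) := {y | (y : Cantor) ∈ loopLabels w}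

/-!
A point `b p z`, with `b` a start and `p` a finite word, is moved by the generators through its
code `(b, p)` alone, whatever the tail `z` is. The graph of this action on codes is the tree
hanging down from a grey vertex, so every Schreier graph is covered by copies of it, one for each
`10σ^k(u)` when `x = a u`. Starts form a prefix code, hence two codes can only name the same point
if `p z = q z` for different words `p` and `q`, that is, if `z` is purely periodic. Therefore trees
hanging at tails that are not purely periodic are embedded and look alike in all Schreier graphs,
while the purely periodic tails in the orbit of `a v w^∞` are the `|w|` shifts of `w^∞`. As the
shift permutes these tails cyclically, their grey vertices are joined into a single loop.
-/

open Function
open Stream' (tail)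

/-! ### Purely periodic words -/

section Words

variable {α : Type*}

theorem iterate_tail (n : ℕ) (z : Stream' α) : tail^[n] z = z.drop n := by
  induction n generalizing z with
  | zero => rfl
  | succ n ih => rw [iterate_succ_apply, ih]; rfl

theorem isPeriodicPt_tail_iff {n : ℕ} {z : Stream' α} :
    IsPeriodicPt tail n z ↔ z.drop n = z := by
  rw [IsPeriodicPt, IsFixedPt, iterate_tail]

theorem drop_mem_periodicPts {z : Stream' α} (hz : z ∈ periodicPts tail) (n : ℕ) :
    z.drop n ∈ periodicPts tail := by
  obtain ⟨m, hm, h⟩ := hz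
  exact ⟨m, hm, iterate_tail n z ▸ h.apply_iterate n⟩

theorem drop_eq_get_append (z : Stream' α) (n : ℕ) :
    z.drop n = [z.get n] ++ₛ z.drop (n + 1) := by
  funext i
  cases i with
  | zero => exact congrArg z (zero_add n)
  | succ i => exact congrArg z (by omega)

theorem drop_length_add_append (p : List α) (z : Stream' α) (n : ℕ) :
    (p ++ₛ z).drop (p.length + n) = z.drop n := by
  rw [← Stream'.drop_drop, Stream'.drop_append_stream]

theorem isPeriodicPt_tail_of_append_eq {p : List α} {z : Stream' α} (h : p ++ₛ z = z) :
    IsPeriodicPt tail p.length z := by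
  rw [isPeriodicPt_tail_iff]
  conv_lhs => rw [← h, Stream'.drop_append_stream]

theorem mem_periodicPts_of_append {p : List α} {z : Stream' α}
    (h : p ++ₛ z ∈ periodicPts tail) : z ∈ periodicPts tail := by
  simpa only [Stream'.drop_append_stream] using drop_mem_periodicPts h p.length

theorem exists_append_of_append_eq_append {p q : List α} {y z : Stream' α}
    (h : p ++ₛ y = q ++ₛ z) (hpq : p.length ≤ q.length) : ∃ r, q = p ++ r ∧ y = r ++ₛ z := by
  have hq : q = q.take p.length ++ q.drop p.length := (List.take_append_drop _ _).symm
  rw [hq, Stream'.append_append_stream] at h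
  have hp : p = q.take p.length :=
    Stream'.append_left_injective _ _ _ _ h (List.length_take_of_le hpq).symm
  rw [← hp] at h hq
  refine ⟨q.drop p.length, hq, ?_⟩
  exact Stream'.append_right_injective _ _ _ h

theorem injOn_append_stream (z : Stream' α) :
    Set.InjOn (· ++ₛ z) {p : List α | ∀ a ∈ p.getLast?, [a] ++ₛ z ∉ periodicPts tail} := by
  intro p hp q hq h
  wlog hpq : p.length ≤ q.length generalizing p q
  · exact (this hq hp h.symm (le_of_not_ge hpq)).symm
  obtain ⟨r, rfl, hr⟩ := exists_append_of_append_eq_append h hpq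
  rcases List.eq_nil_or_concat' r with rfl | ⟨r, a, rfl⟩
  · exact (List.append_nil p).symm
  rw [Stream'.append_append_stream] at hr
  have ha : ([a] ++ r) ++ₛ ([a] ++ₛ z) = [a] ++ₛ z := by
    rw [Stream'.append_append_stream, ← hr]
  exact absurd ⟨_, Nat.succ_pos _, isPeriodicPt_tail_of_append_eq ha⟩ (hq a (by simp))

theorem exists_eq_drop_of_mem_periodicPts {y z : Stream' α} {m k : ℕ}
    (hz : z ∈ periodicPts tail) (h : z.drop m = y.drop k) : ∃ j, z = y.drop j := by
  obtain ⟨n, hn, hzn⟩ := hz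
  obtain ⟨e, he⟩ := Nat.exists_eq_add_of_le (Nat.le_mul_of_pos_left m hn)
  refine ⟨e + k, ?_⟩
  have hz' : z.drop (n * m) = z := isPeriodicPt_tail_iff.1 (hzn.mul_const m)
  rw [← hz', he, add_comm e, ← Stream'.drop_drop, ← Stream'.drop_drop, h]

theorem get_replicate_append_of_lt {c : α} {n i : ℕ} (z : Stream' α) (h : i < n) :
    (List.replicate n c ++ₛ z).get i = c := by
  rw [Stream'.get_append_left _ _ _ (by simpa using h), List.getElem_replicate]

theorem get_replicate_append_cons {c d : α} (n : ℕ) (z : Stream' α) :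
    (List.replicate n c ++ₛ ([d] ++ₛ z)).get n = d := by
  have h := Stream'.get_append_length (List.replicate n c) ([d] ++ₛ z)
  rwa [List.length_replicate] at h

theorem replicate_append_cons_inj {c d : α} (hcd : c ≠ d) {m n : ℕ} {y z : Stream' α}
    (h : List.replicate m c ++ₛ ([d] ++ₛ y) = List.replicate n c ++ₛ ([d] ++ₛ z)) :
    m = n ∧ y = z := by
  wlog hmn : m ≤ n generalizing m n y z
  · exact (this h.symm (le_of_not_ge hmn)).imp Eq.symm Eq.symm
  obtain rfl | hlt := hmn.eq_or_lt
  · exact ⟨rfl, Stream'.append_right_injective _ _ _ (Stream'.append_right_injective _ _ _ h)⟩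
  · have hd := congrArg (Stream'.get · m) h
    simp only [get_replicate_append_cons, get_replicate_append_of_lt _ hlt] at hd
    exact absurd hd.symm hcd

theorem exists_eq_replicate_append_cons {z : Stream' α} (hz : z ≠ Stream'.const (z.get 0)) :
    ∃ n d y, d ≠ z.get 0 ∧ z = List.replicate (n + 1) (z.get 0) ++ₛ ([d] ++ₛ y) := by
  classical
  have hex : ∃ n, z.get n ≠ z.get 0 := by
    by_contra! h
    exact hz (funext h)
  obtain ⟨n, hn⟩ : ∃ n, Nat.find hex = n + 1 := Nat.exists_eq_succ_of_ne_zero fun h =>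
    Nat.find_spec hex (by rw [h])
  have htake : z.take (n + 1) = List.replicate (n + 1) (z.get 0) := by
    refine List.eq_replicate_iff.2 ⟨Stream'.length_take _ _, fun a ha => ?_⟩
    obtain ⟨i, hi, rfl⟩ := List.getElem_of_mem ha
    rw [Stream'.length_take, ← hn] at hi
    rw [Stream'.take_get]
    exact not_not.1 (Nat.find_min hex hi)
  refine ⟨n, z.get (n + 1), z.drop (n + 2), hn ▸ Nat.find_spec hex, ?_⟩
  rw [← htake, ← drop_eq_get_append, Stream'.append_take_drop]

end Words

theorem drop_length_periodic (w : List (Fin 2)) : (periodic w).drop w.length = periodic w :=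
  funext fun n => congrArg (w.getD · 0) (Nat.add_mod_right n w.length)

theorem get_periodic_of_lt {w : List (Fin 2)} {n : ℕ} (h : n < w.length) :
    (periodic w).get n = w[n] := by
  change w.getD (n % w.length) 0 = w[n]
  rw [Nat.mod_eq_of_lt h, List.getD_eq_getElem]

theorem take_length_periodic (w : List (Fin 2)) : (periodic w).take w.length = w :=
  List.ext_getElem (Stream'.length_take _ _) fun i _ hi => by
    rw [Stream'.take_get, get_periodic_of_lt hi]

theorem append_periodic (w : List (Fin 2)) : w ++ₛ periodic w = periodic w := by
  have h := Stream'.append_take_drop w.length (periodic w)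
  rwa [take_length_periodic, drop_length_periodic] at h

theorem periodic_mem_periodicPts {w : List (Fin 2)} (hw : w ≠ []) :
    periodic w ∈ periodicPts tail :=
  mk_mem_periodicPts (List.length_pos_iff.2 hw) (isPeriodicPt_tail_iff.2 (drop_length_periodic w))

theorem eq_of_append_eq_self {α : Type*} {p : List α} (hp : p ≠ []) {y z : Stream' α}
    (hy : p ++ₛ y = y) (hz : p ++ₛ z = z) : y = z := by
  funext n
  induction n using Nat.strong_induction_on with
  | _ n ih =>
    rw [← hy, ← hz]
    rcases lt_or_ge n p.length with hn | hn
    · exact (Stream'.get_append_left _ _ _ hn).trans (Stream'.get_append_left _ _ _ hn).symm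
    · obtain ⟨k, rfl⟩ := Nat.exists_eq_add_of_le hn
      have hk : y k = z k := ih k (by have := List.length_pos_iff.2 hp; omega)
      exact (Stream'.get_append_right _ _ _).trans (hk.trans (Stream'.get_append_right _ _ _).symm)

theorem eq_periodic_of_append_eq {p : List (Fin 2)} (hp : p ≠ []) {z : Cantor}
    (h : p ++ₛ z = z) : z = periodic p :=
  eq_of_append_eq_self hp h (append_periodic p)

theorem flatten_replicate_append_eq {α : Type*} {p : List α} {z : Stream' α} (h : p ++ₛ z = z)
    (n : ℕ) : (List.replicate n p).flatten ++ₛ z = z := by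
  induction n with
  | zero => rfl
  | succ n ih => rw [List.replicate_succ, List.flatten_cons, Stream'.append_append_stream, ih, h]

theorem take_append_eq_of_isPeriodicPt {α : Type*} {z : Stream' α} {n : ℕ}
    (h : IsPeriodicPt tail n z) : z.take n ++ₛ z = z := by
  have hz := Stream'.append_take_drop n z
  rwa [isPeriodicPt_tail_iff.1 h] at hz

theorem isPrimitive_iff_minimalPeriod_eq {w : List (Fin 2)} (hw : w ≠ []) :
    IsPrimitive w ↔ minimalPeriod tail (periodic w) = w.length := by
  have hper : IsPeriodicPt tail w.length (periodic w) :=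
    isPeriodicPt_tail_iff.2 (drop_length_periodic w)
  constructor
  · rintro ⟨-, hprim⟩
    obtain ⟨n, hn⟩ := hper.minimalPeriod_dvd
    set p := (periodic w).take (minimalPeriod tail (periodic w)) with hp
    have hpow : (List.replicate n p).flatten ++ₛ periodic w = w ++ₛ periodic w := by
      rw [append_periodic, flatten_replicate_append_eq
        (take_append_eq_of_isPeriodicPt (isPeriodicPt_minimalPeriod _ _))]
    have hlen : (List.replicate n p).flatten.length = w.length := by
      simp [hp, hn, mul_comm]
    rw [hn, hprim p n (Stream'.append_left_injective _ _ _ _ hpow hlen).symm, mul_one]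
  · refine fun hmin => ⟨hw, fun p n hpn => ?_⟩
    have hp : p ≠ [] := by
      rintro rfl
      exact hw (by simpa using hpn)
    have hpw : periodic p = periodic w :=
      eq_periodic_of_append_eq hw (hpn ▸ flatten_replicate_append_eq (append_periodic p) n)
    have hle : w.length ≤ p.length := hmin ▸ hpw ▸
      (isPeriodicPt_tail_iff.2 (drop_length_periodic p)).minimalPeriod_le (List.length_pos_iff.2 hp)
    have hlen : w.length = n * p.length := by simpa using congrArg List.length hpn
    have hpos := List.length_pos_iff.2 hw
    have := List.length_pos_iff.2 hp
    have : n ≤ 1 := by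
      by_contra! h
      nlinarith
    have : n ≠ 0 := by
      rintro rfl
      omega
    omega

theorem cons_periodic_mem_periodicPts_iff {w : List (Fin 2)} (hw : w ≠ []) {b : Fin 2} :
    [b] ++ₛ periodic w ∈ periodicPts tail ↔ w.getLast? = some b := by
  have hlast : [w.getLast hw] ++ₛ periodic w ∈ periodicPts tail := by
    have h : w.dropLast ++ₛ ([w.getLast hw] ++ₛ periodic w) = periodic w := by
      rw [← Stream'.append_append_stream, List.dropLast_append_getLast, append_periodic]
    exact mem_periodicPts_of_append (h ▸ periodic_mem_periodicPts hw)
  rw [List.getLast?_eq_getLast_of_ne_nil hw, Option.some_inj]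
  refine ⟨fun h => ?_, fun h => h ▸ hlast⟩
  exact congrArg Stream'.head ((bijOn_periodicPts tail).injOn hlast h rfl)

theorem getLast?_eq_of_append_periodic_mem_periodicPts {p w : List (Fin 2)} (hw : w ≠ [])
    (hp : p ≠ []) (h : p ++ₛ periodic w ∈ periodicPts tail) : p.getLast? = w.getLast? := by
  rw [← List.dropLast_append_getLast hp, Stream'.append_append_stream] at h
  rw [(cons_periodic_mem_periodicPts_iff hw).1 (mem_periodicPts_of_append h),
    List.getLast?_eq_getLast_of_ne_nil hp]

theorem drop_append_periodic_mem_periodicPts_iff {v w : List (Fin 2)} (hw : w ≠ [])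
    (hvw : v.getLast? ≠ w.getLast?) {k : ℕ} :
    (v ++ₛ periodic w).drop k ∈ periodicPts tail ↔ v.length ≤ k := by
  constructor
  · intro h
    by_contra! hk
    rw [Stream'.drop_append_of_le_length _ _ _ hk.le] at h
    have hlast := getLast?_eq_of_append_periodic_mem_periodicPts hw
      (List.drop_eq_nil_iff.not.2 hk.not_ge) h
    rw [List.getLast?_drop, if_neg hk.not_ge] at hlast
    exact hvw hlast
  · intro h
    obtain ⟨j, rfl⟩ := Nat.exists_eq_add_of_le h
    rw [drop_length_add_append]
    exact drop_mem_periodicPts (periodic_mem_periodicPts hw) j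

theorem isRational_iff {u : Cantor} : IsRational u ↔ ∃ k, u.drop k ∈ periodicPts tail := by
  simp only [IsRational, mem_periodicPts, isPeriodicPt_tail_iff, Stream'.drop_drop, gt_iff_lt]

theorem IsRational.of_append {p : List (Fin 2)} {u : Cantor} (h : IsRational (p ++ₛ u)) :
    IsRational u := by
  obtain ⟨k, hk⟩ := isRational_iff.1 h
  refine isRational_iff.2 ⟨k, ?_⟩
  have hk' := drop_mem_periodicPts hk p.length
  rwa [Stream'.drop_drop, add_comm, drop_length_add_append] at hk'

theorem exists_append_periodic {u : Cantor} (hu : IsRational u) :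
    ∃ v w, u = v ++ₛ periodic w ∧ IsPrimitive w ∧ v.getLast? ≠ w.getLast? := by
  classical
  have hex := isRational_iff.1 hu
  obtain ⟨k, hk, hmin⟩ : ∃ k, u.drop k ∈ periodicPts tail ∧
      ∀ m < k, u.drop m ∉ periodicPts tail :=
    ⟨Nat.find hex, Nat.find_spec hex, fun _ => Nat.find_min hex⟩
  set w := (u.drop k).take (minimalPeriod tail (u.drop k)) with hw
  have hlen : w.length = minimalPeriod tail (u.drop k) := Stream'.length_take _ _
  have hw0 : w ≠ [] := List.length_pos_iff.1 (hlen ▸ minimalPeriod_pos_of_mem_periodicPts hk)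
  have hper : u.drop k = periodic w := eq_periodic_of_append_eq hw0
    (take_append_eq_of_isPeriodicPt (isPeriodicPt_minimalPeriod _ _))
  refine ⟨u.take k, w, ?_, (isPrimitive_iff_minimalPeriod_eq hw0).2 (by rw [hlen, hper]), ?_⟩
  · rw [← hper, Stream'.append_take_drop]
  · intro hlast
    cases k with
    | zero => exact hw0 (List.getLast?_eq_none_iff.1 hlast.symm)
    | succ k =>
      rw [Stream'.take_succ', List.getLast?_append] at hlast
      refine hmin k k.lt_succ_self ?_
      rw [drop_eq_get_append, hper, cons_periodic_mem_periodicPts_iff hw0, ← hlast]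
      rfl

theorem append_periodic_inj {v w v' w' : List (Fin 2)} (hw : IsPrimitive w) (hw' : IsPrimitive w')
    (hv : v.getLast? ≠ w.getLast?) (hv' : v'.getLast? ≠ w'.getLast?)
    (h : v ++ₛ periodic w = v' ++ₛ periodic w') : v = v' ∧ w = w' := by
  have hlen : v.length = v'.length := eq_of_forall_ge_iff fun k => by
    rw [← drop_append_periodic_mem_periodicPts_iff hw.1 hv, h,
      drop_append_periodic_mem_periodicPts_iff hw'.1 hv']
  obtain rfl : v = v' := Stream'.append_left_injective _ _ _ _ h hlen
  have hper : periodic w = periodic w' := Stream'.append_right_injective _ _ _ h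
  have hlen' : w.length = w'.length := by
    rw [← (isPrimitive_iff_minimalPeriod_eq hw.1).1 hw, hper,
      (isPrimitive_iff_minimalPeriod_eq hw'.1).1 hw']
  rw [← take_length_periodic w, hper, hlen', take_length_periodic]
  exact ⟨rfl, rfl⟩

/-! ### Codes and orbits -/

namespace Start

theorem append_inj {b b' : Start} {y z : Cantor} (h : b.word ++ₛ y = b'.word ++ₛ z) :
    b = b' ∧ y = z := by
  rcases b with m | m <;> rcases b' with n | n
  · simp only [word, Stream'.append_append_stream] at h
    obtain ⟨hmn, hyz⟩ := replicate_append_cons_inj (by decide) h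
    exact ⟨congrArg black (Nat.succ_injective hmn), hyz⟩
  · exact absurd (congrArg Stream'.head h) (show (0 : Fin 2) ≠ 1 by decide)
  · exact absurd (congrArg Stream'.head h) (show (1 : Fin 2) ≠ 0 by decide)
  · simp only [word, Stream'.append_append_stream] at h
    obtain ⟨hmn, hyz⟩ := replicate_append_cons_inj (by decide) h
    exact ⟨congrArg white (Nat.succ_injective hmn), hyz⟩

theorem exists_eq_append {x : Cantor} (h0 : x ≠ constWord 0) (h1 : x ≠ constWord 1) :
    ∃ (b : Start) (z : Cantor), x = b.word ++ₛ z := by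
  obtain hx | hx : x.get 0 = 0 ∨ x.get 0 = 1 := by omega
  · obtain ⟨n, d, z, hd, hz⟩ := exists_eq_replicate_append_cons (hx.symm ▸ h0)
    rw [hx] at hd hz
    obtain rfl : d = 1 := by omega
    exact ⟨black n, z, hz.trans (Stream'.append_append_stream _ _ _).symm⟩
  · obtain ⟨n, d, z, hd, hz⟩ := exists_eq_replicate_append_cons (hx.symm ▸ h1)
    rw [hx] at hd hz
    obtain rfl : d = 0 := by omega
    exact ⟨white n, z, hz.trans (Stream'.append_append_stream _ _ _).symm⟩

end Start

theorem existsUnique_isNormalForm {x : Cantor} (hx : IsRational x) (h0 : x ≠ constWord 0)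
    (h1 : x ≠ constWord 1) :
    ∃! q : Start × List (Fin 2) × List (Fin 2), IsNormalForm x q.1 q.2.1 q.2.2 := by
  obtain ⟨a, u, rfl⟩ := Start.exists_eq_append h0 h1
  obtain ⟨v, w, rfl, hw, hvw⟩ := exists_append_periodic hx.of_append
  refine ⟨(a, v, w), ⟨rfl, hw, hvw⟩, ?_⟩
  rintro ⟨a', v', w'⟩ ⟨h, hw', hvw'⟩
  obtain ⟨rfl, h⟩ := Start.append_inj h
  obtain ⟨rfl, rfl⟩ := append_periodic_inj hw hw' hvw hvw' h
  rfl

/-- Codes `(b, p)`, which name the point `b p z` relative to any given tail `z`. Thompson's group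
acts on the points `b p z` through their codes. -/
abbrev Code : Type := Start × List (Fin 2)

namespace Code

/-- The point `b p z` named by the code `(b, p)` relative to the tail `z`. -/
def label (z : Cantor) (c : Code) : Cantor := c.1.word ++ₛ (c.2 ++ₛ z)

/-- The action of the generators on codes: `x₀` and `x₁` send `b p z` to the point with code
`step s (b, p)`, whatever `z` is. -/
def step : Gen → Code → Code
  | .x0, (.black m, p) => (.black (m + 1), p)
  | .x0, (.white 0, p) => (.black 0, p)
  | .x0, (.white (n + 1), p) => (.white n, p)
  | .x1, (.black m, p) => (.black m, p)
  | .x1, (.white 0, p) => (.white 0, 0 :: p)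
  | .x1, (.white 1, p) => (.white 0, 1 :: p)
  | .x1, (.white (n + 2), p) => (.white (n + 1), p)

theorem perm_label (s : Gen) (z : Cantor) (c : Code) :
    s.perm (label z c) = label z (step s c) := by
  obtain ⟨b, p⟩ := c
  cases s <;> rcases b with m | _ | _ | n <;> rfl

theorem exists_step_eq (s : Gen) (c : Code) : (∃ d, step s d = c) ∨ c = (.white 0, []) := by
  obtain ⟨b, p⟩ := c
  match s, b, p with
  | .x0, .black 0, p => exact .inl ⟨(.white 0, p), rfl⟩
  | .x0, .black (m + 1), p => exact .inl ⟨(.black m, p), rfl⟩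
  | .x0, .white n, p => exact .inl ⟨(.white (n + 1), p), rfl⟩
  | .x1, .black m, p => exact .inl ⟨(.black m, p), rfl⟩
  | .x1, .white 0, [] => exact .inr rfl
  | .x1, .white 0, 0 :: p => exact .inl ⟨(.white 0, p), rfl⟩
  | .x1, .white 0, 1 :: p => exact .inl ⟨(.white 1, p), rfl⟩
  | .x1, .white (n + 1), p => exact .inl ⟨(.white (n + 2), p), rfl⟩

theorem injOn_label (z : Cantor) :
    Set.InjOn (label z) {c | ∀ a ∈ c.2.getLast?, [a] ++ₛ z ∉ periodicPts tail} := by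
  rintro ⟨b, p⟩ hp ⟨b', q⟩ hq h
  obtain ⟨rfl, h⟩ := Start.append_inj h
  exact congrArg (Prod.mk b) (injOn_append_stream z hp hq h)

theorem label_injective {z : Cantor} (hz : z ∉ periodicPts tail) : Injective (label z) :=
  fun _ _ h => injOn_label z (fun _ _ => mt mem_periodicPts_of_append hz)
    (fun _ _ => mt mem_periodicPts_of_append hz) h

theorem label_drop (b : Start) (p : List (Fin 2)) (u : Cantor) (k : ℕ) :
    label (u.drop k) (b, p) = label (u.drop (k + 1)) (b, p ++ [u.get k]) := by
  rw [label, label, drop_eq_get_append, Stream'.append_append_stream]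

end Code

section Orbits

open MulAction Code
open scoped Pointwise

variable {x y z : Cantor}

theorem perm_mem_orbit_iff (s : Gen) : s.perm y ∈ orbit thompsonF x ↔ y ∈ orbit thompsonF x := by
  rw [← orbit_eq_iff, ← orbit_eq_iff]
  exact (orbit_smul s.elt y).congr_left

theorem mem_of_mem_orbit {T : Set Cantor} (hT : ∀ (s : Gen) z, s.perm z ∈ T ↔ z ∈ T)
    (hx : x ∈ T) (hy : y ∈ orbit thompsonF x) : y ∈ T := by
  have hle : thompsonF ≤ stabilizer (Equiv.Perm Cantor) T := by
    rw [thompsonF, Subgroup.closure_le]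
    rintro _ ⟨s, rfl⟩
    exact mem_stabilizer_set.2 (hT s)
  obtain ⟨g, rfl⟩ := hy
  exact (mem_stabilizer_set.1 (hle g.2) x).2 hx

theorem label_step_mem_orbit_iff (s : Gen) (c : Code) :
    label z (step s c) ∈ orbit thompsonF x ↔ label z c ∈ orbit thompsonF x := by
  rw [← perm_label, perm_mem_orbit_iff]

theorem label_mem_orbit_iff_label_white_zero (b : Start) (p : List (Fin 2)) :
    label z (b, p) ∈ orbit thompsonF x ↔ label z (.white 0, p) ∈ orbit thompsonF x := by
  rcases b with m | n
  · induction m with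
    | zero => exact label_step_mem_orbit_iff .x0 (.white 0, p)
    | succ m ih => exact (label_step_mem_orbit_iff .x0 (.black m, p)).trans ih
  · induction n with
    | zero => rfl
    | succ n ih => exact (label_step_mem_orbit_iff .x0 (.white (n + 1), p)).symm.trans ih

theorem label_mem_orbit_iff (c : Code) :
    label z c ∈ orbit thompsonF x ↔ [1, 0] ++ₛ z ∈ orbit thompsonF x := by
  obtain ⟨b, p⟩ := c
  induction p generalizing b with
  | nil => exact label_mem_orbit_iff_label_white_zero b []
  | cons a p ih =>
    rw [label_mem_orbit_iff_label_white_zero]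
    match a with
    | 0 => exact (label_step_mem_orbit_iff .x1 (.white 0, p)).trans (ih _)
    | 1 => exact (label_step_mem_orbit_iff .x1 (.white 1, p)).trans (ih _)

theorem mem_orbit_append_iff {a : Start} {u : Cantor} :
    y ∈ orbit thompsonF (a.word ++ₛ u) ↔ ∃ k c, y = label (u.drop k) c := by
  constructor
  · refine mem_of_mem_orbit (T := {y | ∃ k c, y = label (u.drop k) c}) (fun s z => ?_)
      ⟨0, (a, []), rfl⟩
    constructor
    · rintro ⟨k, c, h⟩
      rcases exists_step_eq s c with ⟨d, rfl⟩ | rfl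
      · exact ⟨k, d, s.perm.injective (h.trans (perm_label s _ d).symm)⟩
      · rw [label_drop] at h
        obtain ⟨d, hd⟩ | hd := exists_step_eq s (.white 0, [] ++ [u.get k])
        · exact ⟨k + 1, d, s.perm.injective (by rw [h, perm_label, hd])⟩
        · simp at hd
    · rintro ⟨k, c, rfl⟩
      exact ⟨k, step s c, perm_label s _ c⟩
  · rintro ⟨k, c, rfl⟩
    rw [label_mem_orbit_iff, ← label_mem_orbit_iff (a, u.take k), label,
      Stream'.append_take_drop]
    exact mem_orbit_self _

theorem schreier_edge_iff {s : Gen} {a b : Orb x} :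
    (schreier x).edge s a b ↔ s.perm (a : Cantor) = b :=
  Subtype.ext_iff

end Orbits

/-! ### Graphs with a spine -/

namespace MarkedGraph

variable {V : Type} {Γ : MarkedGraph V} {l : V → Cantor} {x : Cantor}

theorem exists_iso_schreier (hl : Injective l) (hrange : Set.range l = MulAction.orbit thompsonF x)
    (hedge : ∀ s a b, Γ.edge s a b → s.perm (l a) = l b) (hout : ∀ s a, ∃ b, Γ.edge s a b) :
    ∃ φ : Γ.Iso (schreier x), ∀ a, ((φ.toEquiv a : Orb x) : Cantor) = l a := by
  refine ⟨⟨(Equiv.ofInjective l hl).trans (Equiv.setCongr hrange), fun s a b => ?_⟩,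
    fun _ => rfl⟩
  refine schreier_edge_iff.trans ⟨fun h => ?_, hedge s a b⟩
  obtain ⟨c, hc⟩ := hout s a
  rwa [← hl ((hedge s a c hc).symm.trans h)]

theorem exists_glue_iso_schreier (hrange : Set.range l = MulAction.orbit thompsonF x)
    (hedge : ∀ s a b, Γ.edge s a b → s.perm (l a) = l b) (hout : ∀ s a, ∃ b, Γ.edge s a b) :
    ∃ φ : (Γ.glue l).Iso (schreier x),
      ∀ a, ((φ.toEquiv (Quotient.mk _ a) : Orb x) : Cantor) = l a := by
  obtain ⟨φ, hφ⟩ := exists_iso_schreier (Γ := Γ.glue l) (Setoid.kerLift_injective l)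
    ((Set.range_quot_lift _).trans hrange) (by
      rintro s _ _ ⟨a, b, rfl, rfl, h⟩
      exact hedge s a b h) (by
      rintro s ⟨a⟩
      obtain ⟨b, hb⟩ := hout s a
      exact ⟨Quotient.mk _ b, a, b, rfl, rfl, hb⟩)
  exact ⟨φ, fun a => hφ _⟩

end MarkedGraph

section Spine

variable {I : Type} {down : I → Option (Fin 2 × I)} {L : I → Cantor}

/-- The labels of the vertices of a graph whose spine vertices `i` are labelled `10 L(i)`. -/
def spineLabel (L : I → Cantor) (t : Grey down × Start) : Cantor :=
  Code.label (L t.1.1.1) (t.2, t.1.1.2)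

/-- Going one step down the spine along the letter `a` prepends `a` to the tail of the label. -/
def SpineCompatible (down : I → Option (Fin 2 × I)) (L : I → Cantor) : Prop :=
  ∀ i a j, down i = some (a, j) → L j = [a] ++ₛ L i

theorem Reduced.nil (i : I) : Reduced down (i, []) := fun _ _ _ => nofun

theorem not_reduced_concat_iff {i : I} {p : List (Fin 2)} {a : Fin 2} :
    ¬ Reduced down (i, p ++ [a]) ↔ ∃ j, down i = some (a, j) := by
  simp only [Reduced, List.getLast?_concat, not_forall, not_not, Option.some_inj]
  exact ⟨fun ⟨_, j, hj, hb⟩ => ⟨j, hb ▸ hj⟩, fun ⟨j, hj⟩ => ⟨a, j, hj, rfl⟩⟩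

theorem exists_isChild (a : Fin 2) (c : Grey down) : ∃ d, IsChild down a c d := by
  obtain ⟨⟨i, p⟩, hp⟩ := c
  by_cases h : Reduced down (i, a :: p)
  · exact ⟨⟨_, h⟩, .inl rfl⟩
  obtain rfl : p = [] := by
    by_contra hne
    refine h fun b j hj => ?_
    rw [List.getLast?_cons_of_ne_nil hne]
    exact hp b j hj
  obtain ⟨j, hj⟩ := (not_reduced_concat_iff (p := [])).1 h
  exact ⟨⟨(j, []), .nil j⟩, .inr ⟨rfl, rfl, hj⟩⟩

theorem spineGraph_exists_edge (s : Gen) (t : Grey down × Start) :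
    ∃ t', (spineGraph down).edge s t t' := by
  obtain ⟨c, b⟩ := t
  match s, b with
  | .x0, .black m => exact ⟨_, .x0_black c m⟩
  | .x0, .white 0 => exact ⟨_, .x0_grey c⟩
  | .x0, .white (n + 1) => exact ⟨_, .x0_white c n⟩
  | .x1, .black m => exact ⟨_, .x1_black c m⟩
  | .x1, .white 0 => exact (exists_isChild 0 c).imp' (·, .white 0) fun d => .x1_grey c d
  | .x1, .white 1 => exact (exists_isChild 1 c).imp' (·, .white 0) fun d => .x1_white_one c d
  | .x1, .white (n + 2) => exact ⟨_, .x1_white c n⟩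

namespace SpineCompatible

theorem append_eq_of_isChild (hL : SpineCompatible down L) {a : Fin 2} {c d : Grey down}
    (h : IsChild down a c d) : d.1.2 ++ₛ L d.1.1 = [a] ++ₛ (c.1.2 ++ₛ L c.1.1) := by
  rcases h with h | ⟨hc, hd, h⟩
  · rw [h]
    rfl
  · rw [hc, hd, Stream'.nil_append_stream, Stream'.nil_append_stream, hL _ _ _ h]

theorem perm_spineLabel (hL : SpineCompatible down L) (s : Gen) (t t' : Grey down × Start)
    (h : (spineGraph down).edge s t t') : s.perm (spineLabel L t) = spineLabel L t' := by
  rw [spineLabel, Code.perm_label]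
  rcases h with _ | _ | _ | _ | ⟨c, d, h⟩ | ⟨c, d, h⟩ | _
  case x1_grey | x1_white_one => exact congrArg ([1, 0] ++ₛ ·) (hL.append_eq_of_isChild h).symm
  all_goals rfl

theorem exists_grey (hL : SpineCompatible down L) (i : I) (p : List (Fin 2)) :
    ∃ c : Grey down, c.1.2 ++ₛ L c.1.1 = p ++ₛ L i := by
  induction p using List.reverseRecOn generalizing i with
  | nil => exact ⟨⟨(i, []), .nil i⟩, rfl⟩
  | append_singleton p a ih =>
    by_cases h : Reduced down (i, p ++ [a])
    · exact ⟨⟨_, h⟩, rfl⟩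
    · obtain ⟨j, hj⟩ := not_reduced_concat_iff.1 h
      obtain ⟨c, hc⟩ := ih j
      exact ⟨c, by rw [hc, hL _ _ _ hj, Stream'.append_append_stream]⟩

theorem range_spineLabel (hL : SpineCompatible down L) {a : Start} {u : Cantor}
    (hdrop : ∀ k, ∃ p i, u.drop k = p ++ₛ L i)
    (horb : ∀ i, [1, 0] ++ₛ L i ∈ MulAction.orbit thompsonF (a.word ++ₛ u)) :
    Set.range (spineLabel (down := down) L) = MulAction.orbit thompsonF (a.word ++ₛ u) := by
  refine Set.Subset.antisymm ?_ fun y hy => ?_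
  · rintro _ ⟨t, rfl⟩
    exact (label_mem_orbit_iff _).2 (horb _)
  · obtain ⟨k, ⟨b, p⟩, rfl⟩ := mem_orbit_append_iff.1 hy
    obtain ⟨q, i, hq⟩ := hdrop k
    obtain ⟨c, hc⟩ := hL.exists_grey i (p ++ q)
    refine ⟨(c, b), congrArg (b.word ++ₛ ·) ?_⟩
    rw [hc, hq, Stream'.append_append_stream]

theorem eq_of_append_eq_append (hL : SpineCompatible down L) (hinj : Injective L)
    (hper : ∀ i, L i ∈ periodicPts tail) (hdown : ∀ i, (down i).isSome) {i j : I}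
    {p q : List (Fin 2)} (hp : Reduced down (i, p)) (hq : Reduced down (j, q))
    (h : p ++ₛ L i = q ++ₛ L j) : (i, p) = (j, q) := by
  wlog hpq : p.length ≤ q.length generalizing i j p q
  · exact (this hq hp h.symm (le_of_not_ge hpq)).symm
  obtain ⟨r, rfl, hr⟩ := exists_append_of_append_eq_append h hpq
  rcases List.eq_nil_or_concat' r with rfl | ⟨r, a, rfl⟩
  · rw [hinj hr, List.append_nil]
  · obtain ⟨⟨b, k⟩, hk⟩ := Option.isSome_iff_exists.1 (hdown j)
    rw [Stream'.append_append_stream] at hr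
    have ha : [a] ++ₛ L j ∈ periodicPts tail := mem_periodicPts_of_append (hr ▸ hper i)
    have hb : [b] ++ₛ L j ∈ periodicPts tail := hL _ _ _ hk ▸ hper k
    obtain rfl : a = b := congrArg Stream'.head ((bijOn_periodicPts tail).injOn ha hb rfl)
    exact absurd (by rw [← List.append_assoc, List.getLast?_concat]) (hq a k hk)

theorem spineLabel_injective (hL : SpineCompatible down L) (hinj : Injective L)
    (hper : ∀ i, L i ∈ periodicPts tail) (hdown : ∀ i, (down i).isSome) :
    Injective (spineLabel (down := down) L) := by
  rintro ⟨⟨⟨i, p⟩, hp⟩, b⟩ ⟨⟨⟨j, q⟩, hq⟩, b'⟩ h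
  obtain ⟨rfl, h⟩ := Start.append_inj h
  exact congrArg (·, b) (Subtype.ext (hL.eq_of_append_eq_append hinj hper hdown hp hq h))

end SpineCompatible

end Spine

theorem rayDown_compatible (u : Cantor) : SpineCompatible (rayDown u) u.drop := by
  rintro (_ | k) a j h
  · cases h
  · cases h
    exact drop_eq_get_append u k

theorem append_drop_mem_orbit (a : Start) (u : Cantor) (k : ℕ) :
    [1, 0] ++ₛ u.drop k ∈ MulAction.orbit thompsonF (a.word ++ₛ u) :=
  mem_orbit_append_iff.2 ⟨k, (.white 0, []), rfl⟩

theorem exists_typeB_glue_iso_schreier (a : Start) (u : Cantor) :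
    ∃ φ : ((typeB u).glue (typeBLabel u)).Iso (schreier (a.word ++ₛ u)),
      (∀ t, ((φ.toEquiv (Quotient.mk _ t) : Orb _) : Cantor) = typeBLabel u t) ∧
        φ.toEquiv (Quotient.mk _ (typeBBase u a)) = basePt (a.word ++ₛ u) := by
  have hL := rayDown_compatible u
  obtain ⟨φ, hφ⟩ := MarkedGraph.exists_glue_iso_schreier
    (hL.range_spineLabel (a := a) (fun k => ⟨[], k, rfl⟩) (append_drop_mem_orbit a u))
    hL.perm_spineLabel spineGraph_exists_edge
  exact ⟨φ, hφ, Subtype.ext (hφ _)⟩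

theorem periodic_drop_mod (w : List (Fin 2)) (n : ℕ) :
    (periodic w).drop (n % w.length) = (periodic w).drop n := by
  rw [← iterate_tail, ← iterate_tail]
  exact (isPeriodicPt_tail_iff.2 (drop_length_periodic w)).iterate_mod_apply n

theorem IsPrimitive.injOn_drop_periodic {w : List (Fin 2)} (hw : IsPrimitive w) :
    Set.InjOn (fun n => (periodic w).drop n) (Set.Iio w.length) := by
  have h := iterate_injOn_Iio_minimalPeriod (f := tail) (x := periodic w)
  simpa only [iterate_tail, (isPrimitive_iff_minimalPeriod_eq hw.1).1 hw] using h

theorem cycleDown_compatible (w : List (Fin 2)) :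
    SpineCompatible (cycleDown w) fun i => (periodic w).drop i := by
  intro i a j h
  cases h
  have hi := i.pos
  have hlt := Nat.mod_lt (i + (w.length - 1)) hi
  have hsucc : (periodic w).drop ((i + (w.length - 1)) % w.length + 1) = (periodic w).drop i := by
    rw [← periodic_drop_mod, Nat.mod_add_mod, add_assoc, Nat.sub_add_cancel hi,
      Nat.add_mod_right, periodic_drop_mod]
  change (periodic w).drop ((i + (w.length - 1)) % w.length) = _
  rw [drop_eq_get_append, hsucc, get_periodic_of_lt hlt]
  rfl

namespace IsNormalForm

variable {x : Cantor} {a : Start} {v w : List (Fin 2)}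

theorem exists_loopGraph_iso_schreier (h : IsNormalForm x a v w) :
    ∃ φ : (loopGraph w).Iso (schreier x),
      (∀ t, ((φ.toEquiv t : Orb x) : Cantor)
        = t.2.word ++ₛ (t.1.1.2 ++ₛ (periodic w).drop t.1.1.1)) ∧
      ∃ c : Grey (cycleDown w), c.1.1.val = 0 ∧ c.1.2 = v ∧ φ.toEquiv (c, a) = basePt x := by
  obtain ⟨rfl, hw, hvw⟩ := h
  have hL := cycleDown_compatible w
  have hw0 : 0 < w.length := List.length_pos_iff.2 hw.1
  have hper (i : Fin w.length) : (periodic w).drop i ∈ periodicPts tail :=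
    drop_mem_periodicPts (periodic_mem_periodicPts hw.1) i
  have hdrop (k : ℕ) : ∃ p, ∃ i : Fin w.length,
      (v ++ₛ periodic w).drop k = p ++ₛ (periodic w).drop i := by
    refine ⟨((v ++ₛ periodic w).drop k).take v.length, ⟨k % w.length, Nat.mod_lt _ hw0⟩, ?_⟩
    rw [periodic_drop_mod, ← drop_length_add_append v (periodic w), add_comm v.length,
      ← Stream'.drop_drop v.length, Stream'.append_take_drop]
  have horb (i : Fin w.length) : [1, 0] ++ₛ (periodic w).drop i ∈
      MulAction.orbit thompsonF (a.word ++ₛ (v ++ₛ periodic w)) :=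
    drop_length_add_append v (periodic w) i ▸ append_drop_mem_orbit a _ _
  obtain ⟨φ, hφ⟩ := MarkedGraph.exists_iso_schreier
    (hL.spineLabel_injective (fun i j hij => Fin.ext (hw.injOn_drop_periodic i.2 j.2 hij)) hper
      fun _ => rfl)
    (hL.range_spineLabel hdrop horb) hL.perm_spineLabel spineGraph_exists_edge
  refine ⟨φ, hφ, ⟨(⟨0, hw0⟩, v), fun b j hj hv => hvw ?_⟩, rfl, rfl, Subtype.ext (hφ _)⟩
  exact hv.trans ((cons_periodic_mem_periodicPts_iff hw.1).1 (hL _ _ _ hj ▸ hper j)).symm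

end IsNormalForm

/-! ### Hanging trees and rays -/

namespace MarkedGraph

variable {U V W : Type} {Γ : MarkedGraph U} {Δ : MarkedGraph V} {Θ : MarkedGraph W}

/-- The inverse of an isomorphism of marked graphs. -/
def Iso.symm (φ : Γ.Iso Δ) : Δ.Iso Γ where
  toEquiv := φ.toEquiv.symm
  edge_iff s a b := by
    obtain ⟨a, rfl⟩ := φ.toEquiv.surjective a
    obtain ⟨b, rfl⟩ := φ.toEquiv.surjective b
    simpa using (φ.edge_iff s a b).symm

/-- The composition of isomorphisms of marked graphs. -/
def Iso.trans (φ : Γ.Iso Δ) (ψ : Δ.Iso Θ) : Γ.Iso Θ where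
  toEquiv := φ.toEquiv.trans ψ.toEquiv
  edge_iff s a b := (ψ.edge_iff s _ _).trans (φ.edge_iff s a b)

end MarkedGraph

namespace Code

/-- The graph of the action of the generators on codes. The label map takes it to the Schreier
graph, and is faithful wherever labels are distinct. -/
def graph : MarkedGraph Code where
  edge s c d := step s c = d

/-- The codes, relative to `z`, of the tree hanging down and to the left at `110z`. -/
def leftTree : Set Code :=
  {c | (∃ n, c = (.white (n + 1), [])) ∨ 1 ∈ c.2.getLast?}

/-- The codes, relative to `z`, of the black vertices attached to `10z`. -/
def blackRay : Set Code := Set.range fun m => (.black m, [])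

/-- The codes in `C` together with the ends of the arrows that start in `C`. -/
def outNhd (C : Set Code) : Set Code := C ∪ {d | ∃ s, ∃ c ∈ C, step s c = d}

theorem step_mem_leftTree_iff (s : Gen) {c : Code} (hc : c ≠ (.white 1, [])) :
    step s c ∈ leftTree ↔ c ∈ leftTree := by
  obtain ⟨b, p⟩ := c
  cases s <;> rcases b with m | _ | _ | n <;> rcases p with _ | ⟨e, p⟩ <;>
    simp_all [step, leftTree]

theorem graph_hangsAt_univ : graph.HangsAt Set.univ (.white 0, []) :=
  ⟨trivial, fun _ _ _ _ => ⟨fun _ h => absurd trivial h, fun h => absurd trivial h⟩⟩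

theorem graph_hangsAt_leftTree : graph.HangsAt leftTree (.white 1, []) := by
  have hroot : (.white 1, []) ∈ leftTree := .inl ⟨0, rfl⟩
  refine ⟨hroot, ?_⟩
  rintro s c _ rfl
  by_cases hc : c = (.white 1, [])
  · exact ⟨fun _ _ => hc, fun h => absurd (hc ▸ hroot) h⟩
  · rw [step_mem_leftTree_iff s hc]
    exact ⟨fun h h' => absurd h h', fun h h' => absurd h' h⟩

theorem graph_hangsAt_blackRay : graph.HangsAt blackRay (.black 0, []) := by
  refine ⟨⟨0, rfl⟩, ?_⟩
  rintro s c _ rfl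
  constructor
  · rintro ⟨m, rfl⟩ h
    cases s
    exacts [absurd ⟨m + 1, rfl⟩ h, absurd ⟨m, rfl⟩ h]
  · obtain ⟨b, p⟩ := c
    cases s <;> rcases b with m | _ | _ | n <;> simp_all [step, blackRay]

theorem outNhd_leftTree_subset : outNhd leftTree ⊆ {c | ∀ a ∈ c.2.getLast?, a = 1} := by
  have hleft : leftTree ⊆ {c | ∀ a ∈ c.2.getLast?, a = 1} := by
    rintro c (⟨n, rfl⟩ | h) a ha
    exacts [(nomatch ha), Option.mem_unique ha h]
  rintro d (hd | ⟨s, c, hc, rfl⟩)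
  · exact hleft hd
  · by_cases h : c = (.white 1, [])
    · subst h
      cases s <;> simp [step]
    · exact hleft ((step_mem_leftTree_iff s h).2 hc)

theorem injOn_label_outNhd_leftTree {z : Cantor} (hz : [1] ++ₛ z ∉ periodicPts tail) :
    Set.InjOn (label z) (outNhd leftTree) := by
  refine (injOn_label z).mono ?_
  intro c hc a ha
  rwa [outNhd_leftTree_subset hc a ha]

end Code

section HangingPieces

open Code

variable {x x' z z' : Cantor} {y : Orb x} {y' : Orb x'} {C : Set Code} {c : Code}

/-- The vertices of the Schreier graph of `x` named relative to `z` by the codes in `C`. -/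
def codeSet (x z : Cantor) (C : Set Code) : Set (Orb x) := {y | (y : Cantor) ∈ label z '' C}

theorem treeAt_eq_codeSet (x u : Cantor) : treeAt x u = codeSet x u Set.univ := by
  ext y
  constructor
  · rintro ⟨b, p, h⟩
    exact ⟨(b, p), trivial, h.symm⟩
  · rintro ⟨⟨b, p⟩, -, h⟩
    exact ⟨b, p, h.symm⟩

theorem leftTreeAt_eq_codeSet (x z : Cantor) : leftTreeAt x z = codeSet x z leftTree := by
  ext y
  constructor
  · rintro (⟨n, h⟩ | ⟨b, p, h⟩)
    · exact ⟨_, .inl ⟨n, rfl⟩, h.symm⟩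
    · refine ⟨(b, p ++ [1]), .inr List.getLast?_concat, ?_⟩
      rw [h, label, Stream'.append_append_stream]
  · rintro ⟨⟨b, p⟩, ⟨n, hc⟩ | hp, h⟩
    · rw [hc] at h
      exact .inl ⟨n, h.symm⟩
    · obtain ⟨p, rfl⟩ := List.getLast?_eq_some_iff.1 hp
      refine .inr ⟨b, p, ?_⟩
      rw [← h, label, Stream'.append_append_stream]

theorem hangsAt_codeSet (hC : graph.HangsAt C c)
    (hroot : (.white 0, []) ∈ C → c = (.white 0, [])) (hy : label z c = y) :
    (schreier x).HangsAt (codeSet x z C) y := by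
  refine ⟨⟨c, hC.1, hy⟩, fun s a b hab => ?_⟩
  rw [schreier_edge_iff] at hab
  constructor
  · rintro ⟨d, hd, ha⟩ hb
    have hdC : step s d ∉ C := fun h => hb ⟨_, h, by rw [← perm_label, ha, hab]⟩
    rw [Subtype.ext_iff, ← ha, (hC.2 s d _ rfl).1 hd hdC, hy]
  · rintro ha ⟨d, hd, hb⟩
    rw [Subtype.ext_iff, ← hb, ← hy]
    rcases exists_step_eq s d with ⟨d, rfl⟩ | rfl
    · have hdC : d ∉ C := fun h =>
        ha ⟨d, h, s.perm.injective (by rw [perm_label, hb, hab])⟩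
      rw [(hC.2 s d _ rfl).2 hdC hd]
    · rw [hroot hd]

theorem exists_graph_iso_codeSet (hz : [1, 0] ++ₛ z ∈ MulAction.orbit thompsonF x)
    (hC : Set.InjOn (label z) (outNhd C)) :
    ∃ φ : (graph.induce C).Iso ((schreier x).induce (codeSet x z C)),
      ∀ c, ((φ.toEquiv c : Orb x) : Cantor) = label z c := by
  let f (c : C) : codeSet x z C := ⟨⟨label z c, (label_mem_orbit_iff _).2 hz⟩, c, c.2, rfl⟩
  have hf : Bijective f := by
    constructor
    · intro c d h
      exact Subtype.ext (hC (.inl c.2) (.inl d.2)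
        (congrArg (fun t : codeSet x z C => ((t : Orb x) : Cantor)) h))
    · rintro ⟨y, c, hc, h⟩
      exact ⟨⟨c, hc⟩, Subtype.ext (Subtype.ext h)⟩
  refine ⟨⟨Equiv.ofBijective f hf, fun s c d => schreier_edge_iff.trans ?_⟩, fun c => rfl⟩
  change s.perm (label z c) = label z d ↔ step s c = d
  rw [perm_label, hC.eq_iff (.inr ⟨s, c, c.2, rfl⟩) (.inl d.2)]

theorem exists_iso_codeSet (hz : [1, 0] ++ₛ z ∈ MulAction.orbit thompsonF x)
    (hz' : [1, 0] ++ₛ z' ∈ MulAction.orbit thompsonF x')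
    (hC : Set.InjOn (label z) (outNhd C)) (hC' : Set.InjOn (label z') (outNhd C)) :
    ∃ φ : ((schreier x).induce (codeSet x z C)).Iso ((schreier x').induce (codeSet x' z' C)),
      ∀ (t : codeSet x z C), ∀ c ∈ C, ((t : Orb x) : Cantor) = label z c →
        (((φ.toEquiv t : codeSet x' z' C) : Orb x') : Cantor) = label z' c := by
  obtain ⟨φ, hφ⟩ := exists_graph_iso_codeSet hz hC
  obtain ⟨ψ, hψ⟩ := exists_graph_iso_codeSet hz' hC'
  refine ⟨φ.symm.trans ψ, fun t c hc ht => ?_⟩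
  obtain rfl : φ.toEquiv ⟨c, hc⟩ = t :=
    Subtype.ext (Subtype.ext ((hφ ⟨c, hc⟩).trans ht.symm))
  change ((ψ.toEquiv (φ.toEquiv.symm (φ.toEquiv ⟨c, hc⟩)) : Orb x') : Cantor) = label z' c
  rw [Equiv.symm_apply_apply, hψ]

theorem rootedIso_codeSet (hc : c ∈ C) (hy : label z c = y) (hy' : label z' c = y')
    (hC : Set.InjOn (label z) (outNhd C)) (hC' : Set.InjOn (label z') (outNhd C)) :
    (schreier x).RootedIso (codeSet x z C) y (schreier x') (codeSet x' z' C) y' := by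
  obtain ⟨φ, hφ⟩ := exists_iso_codeSet ((label_mem_orbit_iff c).1 (hy ▸ y.2))
    ((label_mem_orbit_iff c).1 (hy' ▸ y'.2)) hC hC'
  exact ⟨⟨c, hc, hy⟩, ⟨c, hc, hy'⟩, φ,
    Subtype.ext (Subtype.ext ((hφ _ c hc hy.symm).trans hy'))⟩

theorem hangsAt_treeAt (hy : (y : Cantor) = [1, 0] ++ₛ z) :
    (schreier x).HangsAt (treeAt x z) y :=
  treeAt_eq_codeSet x z ▸ hangsAt_codeSet graph_hangsAt_univ (fun _ => rfl) hy.symm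

theorem hangsAt_leftTreeAt (hy : (y : Cantor) = [1, 1, 0] ++ₛ z) :
    (schreier x).HangsAt (leftTreeAt x z) y :=
  leftTreeAt_eq_codeSet x z ▸
    hangsAt_codeSet graph_hangsAt_leftTree (by simp [leftTree]) hy.symm

theorem hangsAt_blackRay (hy : (y : Cantor) = [0, 1] ++ₛ z) :
    (schreier x).HangsAt (codeSet x z blackRay) y :=
  hangsAt_codeSet graph_hangsAt_blackRay (by simp [blackRay]) hy.symm

theorem exists_iso_treeAt (hz : [1, 0] ++ₛ z ∈ MulAction.orbit thompsonF x)
    (hz' : [1, 0] ++ₛ z' ∈ MulAction.orbit thompsonF x')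
    (h : z ∉ periodicPts tail) (h' : z' ∉ periodicPts tail) :
    ∃ φ : ((schreier x).induce (treeAt x z)).Iso ((schreier x').induce (treeAt x' z')),
      ∀ (t : treeAt x z) (b : Start) (p : List (Fin 2)),
        ((t : Orb x) : Cantor) = b.word ++ₛ (p ++ₛ z) →
        (((φ.toEquiv t : treeAt x' z') : Orb x') : Cantor) = b.word ++ₛ (p ++ₛ z') := by
  rw [treeAt_eq_codeSet, treeAt_eq_codeSet]
  obtain ⟨φ, hφ⟩ := exists_iso_codeSet hz hz' (label_injective h).injOn (label_injective h').injOn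
  exact ⟨φ, fun t b p => hφ t (b, p) trivial⟩

theorem rootedIso_treeAt (hy : (y : Cantor) = [1, 0] ++ₛ z) (hy' : (y' : Cantor) = [1, 0] ++ₛ z')
    (h : z ∉ periodicPts tail) (h' : z' ∉ periodicPts tail) :
    (schreier x).RootedIso (treeAt x z) y (schreier x') (treeAt x' z') y' := by
  rw [treeAt_eq_codeSet, treeAt_eq_codeSet]
  exact rootedIso_codeSet (c := (.white 0, [])) trivial hy.symm hy'.symm
    (label_injective h).injOn (label_injective h').injOn

theorem rootedIso_leftTreeAt (hy : (y : Cantor) = [1, 1, 0] ++ₛ z)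
    (hy' : (y' : Cantor) = [1, 1, 0] ++ₛ z')
    (h : [1] ++ₛ z ∉ periodicPts tail) (h' : [1] ++ₛ z' ∉ periodicPts tail) :
    (schreier x).RootedIso (leftTreeAt x z) y (schreier x') (leftTreeAt x' z') y' := by
  rw [leftTreeAt_eq_codeSet, leftTreeAt_eq_codeSet]
  exact rootedIso_codeSet (c := (.white 1, [])) (.inl ⟨0, rfl⟩) hy.symm hy'.symm
    (injOn_label_outNhd_leftTree h) (injOn_label_outNhd_leftTree h')

end HangingPieces

/-! ### Geodesics of black vertices -/

theorem MarkedGraph.isGeodesicRay_of_lipschitz {V : Type} {Γ : MarkedGraph V} {f : V → ℕ}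
    {r : ℕ → V} (hf : ∀ s a b, Γ.edge s a b → f b ≤ f a + 1 ∧ f a ≤ f b + 1)
    (hadj : ∀ m, Γ.Adj (r m) (r (m + 1))) (hr : ∀ m, f (r (m + 1)) = f (r m) + 1) :
    Γ.IsGeodesicRay r := by
  have hfr (m k : ℕ) : f (r (m + k)) = f (r m) + k := by
    induction k with
    | zero => rfl
    | succ k ih => rw [← add_assoc, hr, ih, add_assoc]
  have hwalk {a b : V} (p : Γ.toSimpleGraph.Walk a b) : f b ≤ f a + p.length := by
    induction p with
    | nil => exact le_rfl
    | cons h p ih =>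
      obtain ⟨-, ⟨s, h | h⟩ | ⟨s, h | h⟩⟩ := (SimpleGraph.fromRel_adj _ _ _).1 h <;>
        have := hf s _ _ h <;> rw [SimpleGraph.Walk.length_cons] <;> omega
  have hexists (m k : ℕ) : ∃ p : Γ.toSimpleGraph.Walk (r m) (r (m + k)), p.length = k := by
    induction k with
    | zero => exact ⟨.nil, rfl⟩
    | succ k ih =>
      obtain ⟨p, hp⟩ := ih
      have hne : r (m + k) ≠ r (m + (k + 1)) := fun h => by
        have := congrArg f h
        rw [hfr, hfr] at this
        omega
      have hstep : Γ.toSimpleGraph.Adj (r (m + k)) (r (m + (k + 1))) :=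
        (SimpleGraph.fromRel_adj _ _ _).2 ⟨hne, .inl (hadj (m + k))⟩
      exact ⟨p.concat hstep, by rw [SimpleGraph.Walk.length_concat, hp]⟩
  refine ⟨hadj, fun m k => ?_⟩
  obtain ⟨p, hp⟩ := hexists m k
  obtain ⟨q, hq⟩ := p.reachable.exists_walk_length_eq_dist
  have hle := hwalk q
  rw [hfr, hq, add_le_add_iff_left] at hle
  exact le_antisymm ((SimpleGraph.dist_le p).trans_eq hp) hle

/-- The number of leading zeros of an infinite word, and `0` for the word `000…`. -/
noncomputable def leadingZeros (z : Cantor) : ℕ := sInf {n | z.get n = 1}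

theorem leadingZeros_replicate_append (m : ℕ) (z : Cantor) :
    leadingZeros (List.replicate m 0 ++ₛ ([1] ++ₛ z)) = m := by
  refine IsLeast.csInf_eq ⟨get_replicate_append_cons m z, fun n hn => ?_⟩
  by_contra! hlt
  exact absurd (hn.symm.trans (get_replicate_append_of_lt _ hlt)) (by decide)

/-- The number of leading zeros of a start. -/
def Start.zeros : Start → ℕ
  | .black m => m + 1
  | .white _ => 0

theorem Code.leadingZeros_label (z : Cantor) (c : Code) :
    leadingZeros (c.label z) = c.1.zeros := by
  obtain ⟨m | n, p⟩ := c
  · rw [Code.label, Start.word, Stream'.append_append_stream]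
    exact leadingZeros_replicate_append (m + 1) _
  · exact leadingZeros_replicate_append 0 _

theorem Code.zeros_step (s : Gen) (c : Code) :
    (step s c).1.zeros ≤ c.1.zeros + 1 ∧ c.1.zeros ≤ (step s c).1.zeros + 1 := by
  obtain ⟨b, p⟩ := c
  cases s <;> rcases b with m | _ | _ | n <;> simp [step, Start.zeros]

theorem perm_constWord (s : Gen) (a : Fin 2) : s.perm (constWord a) = constWord a := by
  cases s <;> fin_cases a <;> exact funext fun n => by rcases n with _ | _ | _ | n <;> rfl

theorem leadingZeros_perm (s : Gen) (z : Cantor) :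
    leadingZeros (s.perm z) ≤ leadingZeros z + 1 ∧
      leadingZeros z ≤ leadingZeros (s.perm z) + 1 := by
  by_cases h0 : z = constWord 0
  · simp [h0, perm_constWord]
  by_cases h1 : z = constWord 1
  · simp [h1, perm_constWord]
  obtain ⟨b, z, rfl⟩ := Start.exists_eq_append h0 h1
  change leadingZeros (s.perm (Code.label z (b, []))) ≤ leadingZeros (Code.label z (b, [])) + 1 ∧
    leadingZeros (Code.label z (b, [])) ≤ leadingZeros (s.perm (Code.label z (b, []))) + 1
  rw [Code.perm_label, Code.leadingZeros_label, Code.leadingZeros_label]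
  exact Code.zeros_step s (b, [])

theorem half_eq : half = (Start.white 0).word ++ₛ constWord 0 := by
  funext n
  rcases n with _ | _ | n <;> rfl

/-- The sequence `r` is mapped to its successor by `x₀` and fixed by `x₁`, and its terms have
more and more leading zeros, as in `01z, 001z, 0001z, …`. -/
structure IsBlackRay {x : Cantor} (r : ℕ → Orb x) : Prop where
  edge_x0 : ∀ m, (schreier x).edge .x0 (r m) (r (m + 1))
  edge_x1 : ∀ m, (schreier x).edge .x1 (r m) (r m)
  leadingZeros_succ : ∀ m, leadingZeros (r (m + 1)) = leadingZeros (r m) + 1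

namespace IsBlackRay

variable {x : Cantor} {r : ℕ → Orb x}

theorem isGeodesicRay (hr : IsBlackRay r) : (schreier x).IsGeodesicRay r := by
  refine MarkedGraph.isGeodesicRay_of_lipschitz (f := fun a : Orb x => leadingZeros (a : Cantor))
    (fun s a b hab => ?_) (fun m => ⟨.x0, .inl (hr.edge_x0 m)⟩) hr.leadingZeros_succ
  rw [← schreier_edge_iff.1 hab]
  exact leadingZeros_perm s a

theorem injective (hr : IsBlackRay r) : Injective r :=
  Injective.of_comp (f := fun a : Orb x => leadingZeros (a : Cantor)) <|
    StrictMono.injective <| strictMono_nat_of_lt_succ fun m =>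
      (Nat.lt_succ_self _).trans_eq (hr.leadingZeros_succ m).symm

theorem edge_iff (hr : IsBlackRay r) {s : Gen} {m n : ℕ} :
    (schreier x).edge s (r m) (r n) ↔ (match s with | .x0 => m + 1 | .x1 => m) = n := by
  rw [schreier_edge_iff, ← hr.injective.eq_iff, Subtype.ext_iff]
  cases s
  · rw [schreier_edge_iff.1 (hr.edge_x0 m)]
  · rw [schreier_edge_iff.1 (hr.edge_x1 m)]

end IsBlackRay

theorem isBlackRay_of_eq_black {x z : Cantor} {r : ℕ → Orb x}
    (hr : ∀ m, (r m : Cantor) = (Start.black m).word ++ₛ z) : IsBlackRay r where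
  edge_x0 m := by
    rw [schreier_edge_iff, hr, hr]
    exact Code.perm_label .x0 z (.black m, [])
  edge_x1 m := by
    rw [schreier_edge_iff, hr]
    exact Code.perm_label .x1 z (.black m, [])
  leadingZeros_succ m := by
    rw [hr, hr]
    exact (Code.leadingZeros_label z (.black (m + 1), [])).trans
      (congrArg (· + 1) (Code.leadingZeros_label z (.black m, [])).symm)

theorem isBlackRay_of_eq_half {x : Cantor} {r : ℕ → Orb x}
    (hr : ∀ m, (r m : Cantor) = List.replicate m 0 ++ₛ half) : IsBlackRay r where
  edge_x0 m := by
    rw [schreier_edge_iff, hr, hr]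
    cases m with
    | zero =>
      exact (congrArg x0Perm half_eq).trans (Code.perm_label .x0 (constWord 0) (.white 0, []))
    | succ m => rfl
  edge_x1 m := by
    rw [schreier_edge_iff, hr]
    cases m with
    | zero => exact funext fun n => by rcases n with _ | _ | _ | n <;> rfl
    | succ m => rfl
  leadingZeros_succ m := by
    rw [hr, hr, half, leadingZeros_replicate_append, leadingZeros_replicate_append]

theorem grey_zero_mem_orbit_half :
    [1, 0] ++ₛ constWord 0 ∈ MulAction.orbit thompsonF half :=
  half_eq ▸ MulAction.mem_orbit_self half

theorem replicate_append_half_mem_orbit (m : ℕ) :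
    List.replicate m 0 ++ₛ half ∈ MulAction.orbit thompsonF half := by
  cases m with
  | zero => exact MulAction.mem_orbit_self half
  | succ m =>
    have h := (label_mem_orbit_iff (.black m, [])).2 grey_zero_mem_orbit_half
    rwa [Code.label, Start.word, Stream'.append_append_stream] at h

theorem grey_half_mem_orbit_half : [1, 0] ++ₛ half ∈ MulAction.orbit thompsonF half := by
  have h := (label_mem_orbit_iff (.white 0, [1])).2 grey_zero_mem_orbit_half
  exact h

theorem append_half_notMem_periodicPts (p : List (Fin 2)) : p ++ₛ half ∉ periodicPts tail := by
  intro h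
  obtain ⟨n, hn, h⟩ := mem_periodicPts_of_append h
  rw [isPeriodicPt_tail_iff] at h
  obtain ⟨n, rfl⟩ := Nat.exists_eq_succ_of_ne_zero hn.ne'
  exact absurd (congrArg (Stream'.get · 0) h) (show (0 : Fin 2) ≠ 1 by decide)

theorem exists_geodesicRay {x z : Cantor} {y : Orb x} (hy : (y : Cantor) = [0, 1] ++ₛ z) :
    ∃ (r : ℕ → Orb x) (r' : ℕ → Orb half), r 0 = y ∧
      (∀ m, (r m : Cantor) = (Start.black m).word ++ₛ z) ∧
      (∀ m, (r' m : Cantor) = List.replicate m 0 ++ₛ half) ∧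
      (schreier x).IsGeodesicRay r ∧ (schreier half).IsGeodesicRay r' ∧
      (∀ s m n, (schreier x).edge s (r m) (r n) ↔ (schreier half).edge s (r' m) (r' n)) ∧
      (schreier x).HangsAt (Set.range r) y := by
  have hz : [1, 0] ++ₛ z ∈ MulAction.orbit thompsonF x :=
    (label_mem_orbit_iff (.black 0, [])).1 (Set.mem_of_eq_of_mem hy.symm y.2)
  let r (m : ℕ) : Orb x := ⟨_, (label_mem_orbit_iff (z := z) (.black m, [])).2 hz⟩
  let r' (m : ℕ) : Orb half := ⟨_, replicate_append_half_mem_orbit m⟩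
  have hr : IsBlackRay r := isBlackRay_of_eq_black fun _ => rfl
  have hr' : IsBlackRay r' := isBlackRay_of_eq_half fun _ => rfl
  have hrange : Set.range r = codeSet x z Code.blackRay := by
    ext t
    constructor
    · rintro ⟨m, rfl⟩
      exact ⟨_, ⟨m, rfl⟩, rfl⟩
    · rintro ⟨_, ⟨m, rfl⟩, h⟩
      exact ⟨m, Subtype.ext h⟩
  exact ⟨r, r', Subtype.ext hy.symm, fun _ => rfl, fun _ => rfl, hr.isGeodesicRay,
    hr'.isGeodesicRay, fun _ _ _ => hr.edge_iff.trans hr'.edge_iff.symm,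
    hrange ▸ hangsAt_blackRay hy⟩

/-! ### The nontrivial loop and the path going up -/

section Half

variable {x z : Cantor} {y : Orb x}

theorem exists_rootedIso_leftTreeAt_half (hy : (y : Cantor) = [1, 1, 0] ++ₛ z)
    (h : [1] ++ₛ z ∉ periodicPts tail) :
    ∃ t : Orb half, (t : Cantor) = [1, 1] ++ₛ constWord 0 ∧
      (schreier x).RootedIso (leftTreeAt x z) y
        (schreier half) (leftTreeAt half (constWord 0)) t := by
  have ht : [1, 1] ++ₛ constWord 0 = [1, 1, 0] ++ₛ constWord 0 :=
    funext fun n => by rcases n with _ | _ | _ | n <;> rfl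
  exact ⟨⟨_, (label_mem_orbit_iff (.white 1, [])).2 grey_zero_mem_orbit_half⟩, ht.symm,
    rootedIso_leftTreeAt hy rfl h (append_half_notMem_periodicPts [])⟩

theorem exists_rootedIso_treeAt_half (hy : (y : Cantor) = [1, 0, 0] ++ₛ z)
    (h : [0] ++ₛ z ∉ periodicPts tail) :
    ∃ t : Orb half, (t : Cantor) = [1, 0, 0] ++ₛ half ∧
      (schreier x).RootedIso (treeAt x ([0] ++ₛ z)) y
        (schreier half) (treeAt half ([0] ++ₛ half)) t :=
  ⟨⟨_, (label_mem_orbit_iff (.white 0, [0])).2 grey_half_mem_orbit_half⟩, rfl,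
    rootedIso_treeAt hy rfl h (append_half_notMem_periodicPts [0])⟩

end Half

section Neighbours

variable {x z : Cantor} {p q : Orb x}

theorem edge_x1_of_eq_grey (hp : (p : Cantor) = [1, 0] ++ₛ ([0] ++ₛ z))
    (hq : (q : Cantor) = [1, 0] ++ₛ z) : (schreier x).edge .x1 q p := by
  rw [schreier_edge_iff, hp, hq]
  rfl

theorem exists_white_of_eq_grey (hp : (p : Cantor) = [1, 0] ++ₛ ([1] ++ₛ z))
    (hq : (q : Cantor) = [1, 0] ++ₛ z) :
    ∃ t : Orb x, (t : Cantor) = [1, 1, 0] ++ₛ z ∧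
      (schreier x).edge .x0 t q ∧ (schreier x).edge .x1 t p := by
  have hz : [1, 0] ++ₛ z ∈ MulAction.orbit thompsonF x := Set.mem_of_eq_of_mem hq.symm q.2
  refine ⟨⟨_, (label_mem_orbit_iff (.white 1, [])).2 hz⟩, rfl, ?_, ?_⟩
  · rw [schreier_edge_iff, hq]
    rfl
  · rw [schreier_edge_iff, hp]
    rfl

theorem stepUp_of_eq_grey {b : Fin 2} (hp : (p : Cantor) = [1, 0] ++ₛ ([b] ++ₛ z))
    (hq : (q : Cantor) = [1, 0] ++ₛ z) : StepUp b p q := by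
  refine ⟨⟨_, hp⟩, ⟨_, hq⟩, ?_⟩
  match b with
  | 0 => exact .inl ⟨rfl, edge_x1_of_eq_grey hp hq⟩
  | 1 =>
    obtain ⟨t, ht, h0, h1⟩ := exists_white_of_eq_grey hp hq
    exact .inr ⟨rfl, t, ⟨_, ht⟩, h0, h1⟩

theorem adj_grey {g y : Orb x} (hg : (g : Cantor) = [1, 0] ++ₛ z) (h : (schreier x).Adj g y) :
    (y : Cantor) = [0, 1] ++ₛ z ∨ (y : Cantor) = [1, 1, 0] ++ₛ z ∨
      (y : Cantor) = [1, 0, 0] ++ₛ z ∨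
      (∃ t, z = [0] ++ₛ t ∧ (y : Cantor) = [1, 0] ++ₛ t) ∨
      ∃ t, z = [1] ++ₛ t ∧ (y : Cantor) = [1, 1, 0] ++ₛ t := by
  obtain ⟨s, h | h⟩ := h <;> rw [schreier_edge_iff, hg] at h
  · cases s
    · exact .inl h.symm
    · exact .inr (.inr (.inl h.symm))
  · cases s
    · exact .inr (.inl (x0Perm.injective h))
    · have hz : z = [z.get 0] ++ₛ z.drop 1 := drop_eq_get_append z 0
      generalize z.drop 1 = t, z.get 0 = b at hz
      subst hz
      match b with
      | 0 => exact .inr (.inr (.inr (.inl ⟨t, rfl, x1Perm.injective h⟩)))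
      | 1 => exact .inr (.inr (.inr (.inr ⟨t, rfl, x1Perm.injective h⟩)))

end Neighbours

section LoopLabels

variable {P z : Cantor} {w : List (Fin 2)}

/-- The part of the loop that comes from the step up from `10σ^i(P)` to `10σ^(i+1)(P)`: the lower
end of the step, followed by its white vertex if the step turns right. -/
def stepLabels (P : Cantor) (i : ℕ) : List Cantor :=
  if P.get i = 0 then [[1, 0] ++ₛ P.drop i]
  else [[1, 0] ++ₛ P.drop i, [1, 1, 0] ++ₛ P.drop (i + 1)]

theorem loopLabels_eq_flatMap (w : List (Fin 2)) :
    loopLabels w = (List.range w.length).flatMap (stepLabels (periodic w)) := rfl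

theorem mem_stepLabels_iff {i : ℕ} {y : Cantor} :
    y ∈ stepLabels P i ↔
      y = [1, 0] ++ₛ P.drop i ∨ ∃ z, P.drop i = [1] ++ₛ z ∧ y = [1, 1, 0] ++ₛ z := by
  rw [drop_eq_get_append P i, stepLabels, drop_eq_get_append P i]
  generalize P.drop (i + 1) = t, P.get i = b
  match b with
  | 0 =>
    rw [if_pos rfl, List.mem_singleton]
    refine (or_iff_left ?_).symm
    rintro ⟨z, h, -⟩
    exact absurd (congrArg Stream'.head h) (show (0 : Fin 2) ≠ 1 by decide)
  | 1 =>
    rw [if_neg (by decide), List.mem_pair]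
    refine or_congr_right ⟨fun h => ⟨t, rfl, h⟩, ?_⟩
    rintro ⟨z, h, rfl⟩
    rw [Stream'.append_right_injective _ _ _ h]

theorem grey_ne_white (y z : Cantor) : [1, 0] ++ₛ y ≠ [1, 1, 0] ++ₛ z := fun h =>
  absurd (congrArg (Stream'.get · 1) h) (show (0 : Fin 2) ≠ 1 by decide)

theorem grey_mem_stepLabels_iff {i : ℕ} : [1, 0] ++ₛ z ∈ stepLabels P i ↔ P.drop i = z := by
  rw [mem_stepLabels_iff]
  constructor
  · rintro (h | ⟨t, -, h⟩)
    exacts [(Stream'.append_right_injective _ _ _ h).symm, absurd h (grey_ne_white z t)]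
  · rintro rfl
    exact .inl rfl

theorem white_mem_stepLabels_iff {i : ℕ} :
    [1, 1, 0] ++ₛ z ∈ stepLabels P i ↔ P.drop i = [1] ++ₛ z := by
  rw [mem_stepLabels_iff]
  constructor
  · rintro (h | ⟨t, ht, h⟩)
    exacts [absurd h.symm (grey_ne_white _ z), ht.trans (congrArg _
      (Stream'.append_right_injective _ _ _ h).symm)]
  · exact fun h => .inr ⟨z, h, rfl⟩

theorem drop_eq_drop_of_mem_stepLabels {i j : ℕ} {y : Cantor} (hi : y ∈ stepLabels P i)
    (hj : y ∈ stepLabels P j) : P.drop i = P.drop j := by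
  rcases mem_stepLabels_iff.1 hi with rfl | ⟨z, hz, rfl⟩
  · exact (grey_mem_stepLabels_iff.1 hj).symm
  · exact hz.trans (white_mem_stepLabels_iff.1 hj).symm

theorem nodup_stepLabels (P : Cantor) (i : ℕ) : (stepLabels P i).Nodup := by
  rw [stepLabels]
  split_ifs
  · exact List.nodup_singleton _
  · exact List.nodup_cons.2 ⟨by simpa using grey_ne_white _ _, List.nodup_singleton _⟩

theorem IsPrimitive.nodup_loopLabels (hw : IsPrimitive w) : (loopLabels w).Nodup := by
  rw [loopLabels_eq_flatMap]
  refine List.nodup_flatMap.2 ⟨fun i _ => nodup_stepLabels _ i, ?_⟩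
  refine List.Pairwise.imp_of_mem (fun {i j} hi hj hij y hyi hyj => ?_) List.nodup_range
  exact hij (hw.injOn_drop_periodic (List.mem_range.1 hi) (List.mem_range.1 hj)
    (drop_eq_drop_of_mem_stepLabels hyi hyj))

theorem mem_loopLabels_iff {y : Cantor} :
    y ∈ loopLabels w ↔ ∃ i < w.length, y ∈ stepLabels (periodic w) i := by
  simp only [loopLabels_eq_flatMap, List.mem_flatMap, List.mem_range]

theorem isChain_flatMap_stepLabels (P : Cantor) (n : ℕ) :
    List.IsChain (orbitalGraph Cantor).Adj
      ((List.range n).flatMap (stepLabels P) ++ [[1, 0] ++ₛ P.drop n]) := by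
  induction n with
  | zero => exact List.isChain_singleton _
  | succ n ih =>
    rw [List.range_succ, List.flatMap_append, List.flatMap_singleton, List.append_assoc]
    rw [drop_eq_get_append P n] at ih
    rw [stepLabels, drop_eq_get_append P n]
    generalize P.drop (n + 1) = t, P.get n = b at ih ⊢
    match b with
    | 0 =>
      rw [if_pos rfl]
      exact List.isChain_split.2 ⟨ih, List.isChain_pair.2 ⟨.x1, .inr rfl⟩⟩
    | 1 =>
      rw [if_neg (by decide)]
      refine List.isChain_split.2 ⟨ih, ?_⟩
      exact List.isChain_cons_cons.2 ⟨⟨.x1, .inr rfl⟩, List.isChain_pair.2 ⟨.x0, .inl rfl⟩⟩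

theorem take_one_loopLabels (hw : w ≠ []) :
    (loopLabels w).take 1 = [[1, 0] ++ₛ (periodic w).drop w.length] := by
  obtain ⟨n, hn⟩ := Nat.exists_eq_succ_of_ne_zero (List.length_pos_iff.2 hw).ne'
  rw [drop_length_periodic, loopLabels_eq_flatMap, hn, List.range_succ_eq_map, List.flatMap_cons,
    stepLabels]
  split_ifs <;> rfl

end LoopLabels

namespace IsNormalForm

variable {x z : Cantor} {a : Start} {v w : List (Fin 2)} {y : Orb x}

theorem grey_mem_orbit (h : IsNormalForm x a v w) (k : ℕ) :
    [1, 0] ++ₛ (v ++ₛ periodic w).drop k ∈ MulAction.orbit thompsonF x :=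
  h.1 ▸ append_drop_mem_orbit a _ k

theorem grey_periodic_mem_orbit (h : IsNormalForm x a v w) (i : ℕ) :
    [1, 0] ++ₛ (periodic w).drop i ∈ MulAction.orbit thompsonF x :=
  drop_length_add_append v (periodic w) i ▸ h.grey_mem_orbit (v.length + i)

theorem mem_periodicPts_iff (h : IsNormalForm x a v w)
    (hz : [1, 0] ++ₛ z ∈ MulAction.orbit thompsonF x) :
    z ∈ periodicPts tail ↔ ∃ i < w.length, (periodic w).drop i = z := by
  constructor
  · intro hper
    rw [h.1, mem_orbit_append_iff] at hz
    obtain ⟨k, ⟨b, p⟩, hkp⟩ := hz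
    obtain ⟨-, rfl⟩ := Start.append_inj (b := .white 0) hkp
    have htail : (p ++ₛ (v ++ₛ periodic w).drop k).drop (p.length + v.length) =
        (periodic w).drop k := by
      rw [drop_length_add_append, Stream'.drop_drop, add_comm, drop_length_add_append]
    obtain ⟨j, hj⟩ := exists_eq_drop_of_mem_periodicPts hper htail
    refine ⟨j % w.length, Nat.mod_lt _ (List.length_pos_iff.2 h.2.1.1), ?_⟩
    rw [periodic_drop_mod, hj]
  · rintro ⟨i, -, rfl⟩
    exact drop_mem_periodicPts (periodic_mem_periodicPts h.2.1.1) i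

theorem grey_mem_loopSet_iff (h : IsNormalForm x a v w) (hy : (y : Cantor) = [1, 0] ++ₛ z) :
    y ∈ loopSet x w ↔ z ∈ periodicPts tail := by
  rw [h.mem_periodicPts_iff (Set.mem_of_eq_of_mem hy.symm y.2)]
  change (y : Cantor) ∈ loopLabels w ↔ _
  simp only [hy, mem_loopLabels_iff, grey_mem_stepLabels_iff]

theorem white_mem_loopSet_iff (h : IsNormalForm x a v w) (hy : (y : Cantor) = [1, 1, 0] ++ₛ z) :
    y ∈ loopSet x w ↔ [1] ++ₛ z ∈ periodicPts tail := by
  have hz : [1, 0] ++ₛ z ∈ MulAction.orbit thompsonF x :=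
    (label_mem_orbit_iff (.white 1, [])).1 (Set.mem_of_eq_of_mem hy.symm y.2)
  rw [h.mem_periodicPts_iff ((label_mem_orbit_iff (.white 0, [1])).2 hz)]
  change (y : Cantor) ∈ loopLabels w ↔ _
  simp only [hy, mem_loopLabels_iff, white_mem_stepLabels_iff]

theorem mem_orbit_of_mem_loopLabels (h : IsNormalForm x a v w) {y : Cantor}
    (hy : y ∈ loopLabels w) : y ∈ MulAction.orbit thompsonF x := by
  obtain ⟨i, -, hy⟩ := mem_loopLabels_iff.1 hy
  have hi := h.grey_periodic_mem_orbit i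
  rcases mem_stepLabels_iff.1 hy with rfl | ⟨z, hz, rfl⟩
  · exact hi
  · rw [hz] at hi
    exact (label_mem_orbit_iff (.white 1, [])).2 ((label_mem_orbit_iff (.white 0, [1])).1 hi)

theorem exists_loop (h : IsNormalForm x a v w) :
    ∃ l : List (Orb x), l.map Subtype.val = loopLabels w ∧ l.Nodup ∧
      List.IsChain (schreier x).Adj (l ++ l.take 1) := by
  obtain ⟨l, hl⟩ : ∃ l : List (Orb x), l.map Subtype.val = loopLabels w :=
    CanLift.prf (loopLabels w) fun y hy => h.mem_orbit_of_mem_loopLabels hy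
  refine ⟨l, hl, .of_map _ (hl ▸ h.2.1.nodup_loopLabels), ?_⟩
  refine List.isChain_of_isChain_map (S := (orbitalGraph Cantor).Adj) Subtype.val ?_ ?_
  · rintro p q ⟨s, hpq | hqp⟩
    exacts [⟨s, .inl (schreier_edge_iff.2 hpq)⟩, ⟨s, .inr (schreier_edge_iff.2 hqp)⟩]
  · rw [List.map_append, List.map_take, hl, take_one_loopLabels h.2.1.1]
    exact isChain_flatMap_stepLabels _ _

theorem ncard_grey_loopSet (h : IsNormalForm x a v w) :
    {y : Orb x | y ∈ loopSet x w ∧ IsGrey y}.ncard = w.length := by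
  let f (i : ℕ) : Orb x := ⟨_, h.grey_periodic_mem_orbit i⟩
  have hf : Set.InjOn f (Set.Iio w.length) := fun i hi j hj hij => h.2.1.injOn_drop_periodic hi hj
    (Stream'.append_right_injective _ _ _ (congrArg Subtype.val hij))
  have himage : {y : Orb x | y ∈ loopSet x w ∧ IsGrey y} = f '' Set.Iio w.length := by
    ext y
    constructor
    · rintro ⟨hy, z, hz⟩
      rw [h.grey_mem_loopSet_iff hz, h.mem_periodicPts_iff (hz ▸ y.2)] at hy
      obtain ⟨i, hi, rfl⟩ := hy
      exact ⟨i, hi, Subtype.ext hz.symm⟩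
    · rintro ⟨i, -, rfl⟩
      exact ⟨(h.grey_mem_loopSet_iff rfl).2
        (drop_mem_periodicPts (periodic_mem_periodicPts h.2.1.1) i), _, rfl⟩
  rw [himage, hf.ncard_image, Set.ncard_Iio_nat]

theorem adj_loopSet (h : IsNormalForm x a v w) {g : Orb x} (hg : g ∈ loopSet x w)
    (hgz : (g : Cantor) = [1, 0] ++ₛ z) (hadj : (schreier x).Adj g y) (hy : y ∉ loopSet x w) :
    (y : Cantor) = [0, 1] ++ₛ z ∨
      ((y : Cantor) = [1, 1, 0] ++ₛ z ∧ [1] ++ₛ z ∉ periodicPts tail) ∨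
      ((y : Cantor) = [1, 0, 0] ++ₛ z ∧ [0] ++ₛ z ∉ periodicPts tail) := by
  rw [h.grey_mem_loopSet_iff hgz] at hg
  rcases adj_grey hgz hadj with hyz | hyz | hyz | ⟨t, rfl, hyt⟩ | ⟨t, rfl, hyt⟩
  · exact .inl hyz
  · exact .inr (.inl ⟨hyz, mt (h.white_mem_loopSet_iff hyz).2 hy⟩)
  · exact .inr (.inr ⟨hyz, mt (h.grey_mem_loopSet_iff hyz).2 hy⟩)
  · exact absurd ((h.grey_mem_loopSet_iff hyt).2 (drop_mem_periodicPts hg 1)) hy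
  · exact absurd ((h.white_mem_loopSet_iff hyt).2 hg) hy

end IsNormalForm

section Ascent

variable {x : Cantor} {a : Start} {v w : List (Fin 2)} {b : Fin 2} {g : ℕ → Orb x}

theorem injOn_drop_append_periodic (hw : IsPrimitive w) (hvw : v.getLast? ≠ w.getLast?) :
    Set.InjOn (fun k => (v ++ₛ periodic w).drop k) {k | k < (v ++ w).length} := by
  intro i hi j hj hij
  wlog hle : i ≤ j generalizing i j
  · exact (this hj hi hij.symm (le_of_not_ge hle)).symm
  by_contra hne
  have hper : (v ++ₛ periodic w).drop i ∈ periodicPts tail := by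
    refine ⟨j - i, by omega, isPeriodicPt_tail_iff.2 ?_⟩
    rw [Stream'.drop_drop, Nat.add_sub_cancel' hle]
    exact hij.symm
  have hi' : v.length ≤ i := (drop_append_periodic_mem_periodicPts_iff hw.1 hvw).1 hper
  obtain ⟨i, rfl⟩ := Nat.exists_eq_add_of_le hi'
  obtain ⟨j, rfl⟩ := Nat.exists_eq_add_of_le (hi'.trans hle)
  simp only [drop_length_add_append, Set.mem_ofPred_eq, List.length_append,
    add_lt_add_iff_left] at hi hj hij
  exact hne (congrArg _ (hw.injOn_drop_periodic hi hj hij))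

theorem get_append_periodic_of_lt {k : ℕ} (hk : k < (v ++ w).length) :
    (v ++ₛ periodic w).get k = (v ++ w)[k] := by
  rw [← append_periodic w, ← Stream'.append_append_stream, Stream'.get_append_left _ _ _ hk]

theorem drop_length_sub_one_periodic (hb : w.getLast? = some b) :
    (periodic w).drop (w.length - 1) = [b] ++ₛ periodic w := by
  obtain ⟨w, rfl⟩ := List.getLast?_eq_some_iff.1 hb
  rw [List.length_append, List.length_singleton, Nat.add_sub_cancel]
  conv_lhs => rw [← append_periodic, Stream'.append_append_stream, Stream'.drop_append_stream]

/-- The sequence `g` is the path `10u, 10σ(u), 10σ²(u), …` that goes up from `10u`. -/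
def IsAscent {x : Cantor} (g : ℕ → Orb x) (u : Cantor) : Prop :=
  ∀ k, (g k : Cantor) = [1, 0] ++ₛ u.drop k

theorem IsNormalForm.exists_isAscent (h : IsNormalForm x a v w) :
    ∃ g : ℕ → Orb x, IsAscent g (v ++ₛ periodic w) :=
  ⟨fun k => ⟨_, h.grey_mem_orbit k⟩, fun _ => rfl⟩

namespace IsAscent

theorem stepUp {u : Cantor} (hg : IsAscent g u) (k : ℕ) : StepUp (u.get k) (g k) (g (k + 1)) :=
  stepUp_of_eq_grey ((hg k).trans (congrArg _ (drop_eq_get_append u k))) (hg (k + 1))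

theorem injOn (hg : IsAscent g (v ++ₛ periodic w)) (hw : IsPrimitive w)
    (hvw : v.getLast? ≠ w.getLast?) : Set.InjOn g {k | k < (v ++ w).length} := by
  intro i hi j hj hij
  refine injOn_drop_append_periodic hw hvw hi hj (Stream'.append_right_injective [1, 0] _ _ ?_)
  rw [← hg, ← hg, hij]

theorem apply_length (hg : IsAscent g (v ++ₛ periodic w)) :
    (g v.length : Cantor) = [1, 0] ++ₛ periodic w := by
  rw [hg, Stream'.drop_append_stream]

theorem apply_length_add_length_sub_one (hg : IsAscent g (v ++ₛ periodic w))
    (hb : w.getLast? = some b) :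
    (g (v.length + (w.length - 1)) : Cantor) = [1, 0] ++ₛ ([b] ++ₛ periodic w) := by
  rw [hg, drop_length_add_append, drop_length_sub_one_periodic hb]

theorem edge_x1_closing (hg : IsAscent g (v ++ₛ periodic w)) (h0 : w.getLast? = some 0) :
    (schreier x).edge .x1 (g v.length) (g (v.length + (w.length - 1))) :=
  edge_x1_of_eq_grey (hg.apply_length_add_length_sub_one h0) hg.apply_length

theorem exists_white_closing (hg : IsAscent g (v ++ₛ periodic w)) (h1 : w.getLast? = some 1) :
    ∃ t : Orb x, (t : Cantor) = [1, 1, 0] ++ₛ periodic w ∧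
      (schreier x).edge .x0 t (g v.length) ∧
      (schreier x).edge .x1 t (g (v.length + (w.length - 1))) :=
  exists_white_of_eq_grey (hg.apply_length_add_length_sub_one h1) hg.apply_length

end IsAscent

end Ascent

theorem mainTheorem3 (x : Cantor) (hx : IsRational x)
    (hx0 : x ≠ constWord 0) (hx1 : x ≠ constWord 1) :
    -- existence and uniqueness of the normal form
    (∃! q : Start × List (Fin 2) × List (Fin 2), IsNormalForm x q.1 q.2.1 q.2.2) ∧
    ∀ (a : Start) (v w : List (Fin 2)), IsNormalForm x a v w →
      -- the Schreier graph is the limit graph of type B with vertices of equal label glued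
      (∃ φ : ((typeB (v ++ₛ periodic w)).glue (typeBLabel (v ++ₛ periodic w))).Iso (schreier x),
        (∀ t, ((φ.toEquiv (Quotient.mk _ t) : Orb x) : Cantor)
          = typeBLabel (v ++ₛ periodic w) t) ∧
        φ.toEquiv (Quotient.mk _ (typeBBase (v ++ₛ periodic w) a)) = basePt x) ∧
      -- explicitly, it is one loop with `|w|` grey vertices and with trees attached
      (∃ φ : (loopGraph w).Iso (schreier x),
        (∀ t, ((φ.toEquiv t : Orb x) : Cantor)
          = t.2.word ++ₛ (t.1.1.2 ++ₛ (periodic w).drop t.1.1.1)) ∧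
        ∃ c : Grey (cycleDown w), c.1.1.val = 0 ∧ c.1.2 = v ∧ φ.toEquiv (c, a) = basePt x) ∧
      -- trees hanging from the grey vertices outside the loop
      (∀ (y : Orb x) (u : Cantor), (y : Cantor) = [1, 0] ++ₛ u →
        (∀ i : ℕ, u ≠ (periodic w).drop i) →
        (schreier x).HangsAt (treeAt x u) y ∧
        ∃ φ : ((schreier x).induce (treeAt x u)).Iso ((schreier half).induce (treeAt half half)),
          ∀ (t : treeAt x u) (b : Start) (p : List (Fin 2)),
            ((t : Orb x) : Cantor) = b.word ++ₛ (p ++ₛ u) →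
            (((φ.toEquiv t : treeAt half half) : Orb half) : Cantor) = b.word ++ₛ (p ++ₛ half)) ∧
      -- the path going up, and the loop
      (∃ g : ℕ → Orb x,
        (∀ k, (g k : Cantor) = [1, 0] ++ₛ (v ++ₛ periodic w).drop k) ∧
        (∀ (k : ℕ) (hk : k < (v ++ w).length), k + 1 < (v ++ w).length →
          StepUp ((v ++ w)[k]) (g k) (g (k + 1))) ∧
        Set.InjOn g {k | k < (v ++ w).length} ∧
        (w.getLast? = some 0 →
          (schreier x).edge .x1 (g v.length) (g (v.length + (w.length - 1)))) ∧
        (w.getLast? = some 1 →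
          ∃ t : Orb x, (t : Cantor) = [1, 1, 0] ++ₛ periodic w ∧
            (schreier x).edge .x0 t (g v.length) ∧
            (schreier x).edge .x1 t (g (v.length + (w.length - 1))))) ∧
      (∃ l : List (Orb x), l.map Subtype.val = loopLabels w ∧ l.Nodup ∧
        List.IsChain (schreier x).Adj (l ++ l.take 1)) ∧
      {y : Orb x | y ∈ loopSet x w ∧ IsGrey y}.ncard = w.length ∧
      -- what is attached to the grey vertices of the loop
      (∀ (g y : Orb x) (z : Cantor), g ∈ loopSet x w → (g : Cantor) = [1, 0] ++ₛ z →
        (schreier x).Adj g y → y ∉ loopSet x w →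
        -- a geodesic isomorphic to the geodesic `1, 01, 001, …` of `1/2`
        (∃ (r : ℕ → Orb x) (r' : ℕ → Orb half), r 0 = y ∧
          (∀ m, (r m : Cantor) = (Start.black m).word ++ₛ z) ∧
          (∀ m, (r' m : Cantor) = List.replicate m 0 ++ₛ half) ∧
          (schreier x).IsGeodesicRay r ∧ (schreier half).IsGeodesicRay r' ∧
          (∀ s m n, (schreier x).edge s (r m) (r n) ↔ (schreier half).edge s (r' m) (r' n)) ∧
          (schreier x).HangsAt (Set.range r) y) ∨
        -- the tree hanging down and to the left at the vertex `11` of `1/2`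
        ((y : Cantor) = [1, 1, 0] ++ₛ z ∧
          (schreier x).HangsAt (leftTreeAt x z) y ∧
          ∃ t : Orb half, (t : Cantor) = [1, 1] ++ₛ constWord 0 ∧
            (schreier x).RootedIso (leftTreeAt x z) y
              (schreier half) (leftTreeAt half (constWord 0)) t) ∨
        -- the tree hanging down and to the right at the vertex `101` of `1/2`
        ((y : Cantor) = [1, 0, 0] ++ₛ z ∧
          (schreier x).HangsAt (treeAt x ([0] ++ₛ z)) y ∧
          ∃ t : Orb half, (t : Cantor) = [1, 0, 0] ++ₛ half ∧
            (schreier x).RootedIso (treeAt x ([0] ++ₛ z)) y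
              (schreier half) (treeAt half ([0] ++ₛ half)) t)) := by
  refine ⟨existsUnique_isNormalForm hx hx0 hx1, fun a v w h => ?_⟩
  obtain ⟨g, hg⟩ := h.exists_isAscent
  refine ⟨h.1 ▸ exists_typeB_glue_iso_schreier a _, h.exists_loopGraph_iso_schreier, ?_,
    ⟨g, hg, fun k hk _ => get_append_periodic_of_lt hk ▸ hg.stepUp k, hg.injOn h.2.1 h.2.2,
      hg.edge_x1_closing, hg.exists_white_closing⟩, h.exists_loop, h.ncard_grey_loopSet, ?_⟩
  · intro y u hy hu
    have hyu : [1, 0] ++ₛ u ∈ MulAction.orbit thompsonF x := Set.mem_of_eq_of_mem hy.symm y.2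
    have hper : u ∉ Function.periodicPts Stream'.tail := fun h' =>
      have ⟨i, _, hi⟩ := (h.mem_periodicPts_iff hyu).1 h'
      hu i hi.symm
    exact ⟨hangsAt_treeAt hy, exists_iso_treeAt hyu grey_half_mem_orbit_half hper
      (append_half_notMem_periodicPts [])⟩
  · intro g y z hg hgz hadj hy
    rcases h.adj_loopSet hg hgz hadj hy with hblack | ⟨hleft, hper⟩ | ⟨hright, hper⟩
    · exact .inl (exists_geodesicRay hblack)
    · exact .inr (.inl ⟨hleft, hangsAt_leftTreeAt hleft,
        exists_rootedIso_leftTreeAt_half hleft hper⟩)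
    · exact .inr (.inr ⟨hright, hangsAt_treeAt hright,
        exists_rootedIso_treeAt_half hright hper⟩)
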